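/- **Setting.** For $a>0$ let $\mathfrak D(a)=\{t\in\mathbb C:\operatorname{dist}(t,(0,+\infty))<a\}$, with boundary $\gamma(a)$. For $a>0$, $R\ge 0$ let $H(a,R)$ be the space of functions $F$ that are analytic in $\mathfrak D(a)$, have at most exponential growth at infinity in each $\mathfrak D(A)$, $0<A<a$, and satisfy $$\|F\|_{r,A}=\int_{\gamma(A)}e^{-r|t|}\,|F(t)|\,|dt|<\infty\qquad\text{for all } r>R,\ 0<A<a .$$ For $\Re\alpha>-1$ put $\mathcal L\{F\}(\zeta)=\zeta\int_0^\infty e^{-\zeta t}F(t)\,dt$ and $\mathcal L_\alpha\{F\}(\zeta)=\zeta^\alpha\mathcal L\{t^\alpha F(t)\}(\zeta)$ (principal powers), and let $\mathcal I_\alpha=\mathcal L_\alpha^{-1}\mathcal L$ be the fractional integral of order $\alpha$: $\mathcal I_\alpha F$ is the function $G\in\bigcup_{a'>0,R'\ge0}H(a',R')$ with $\mathcal L_\alpha\{G\}=\mathcal L\{F\}$. **Theorem.** Let $a>0$, $R\ge0$, $\Re\alpha>-1$ and $F\in H(a,R)$. Then $F^*(t,\alpha)=\mathcal I_\alpha\{F(t)\}$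 exists and is unique (on the common region of analyticity), the transforms $\mathcal L_\alpha\{F^*(\cdot,\alpha)\}$ and $\mathcal L\{F\}$ converge absolutely and agree for $\Re\zeta>R$, and the following holds. (i) For all $r$ with $R<r<\infty$, all $A$ with $0<A<a$ and all $t\in\mathfrak D(A)$, $$F^*(t,\alpha)=\sum_{k=0}^\infty\frac{(rt)^k}{\Gamma(\alpha+k+1)}\,f_k^*(\alpha,r,t),\qquad f_k^*(\alpha,r,t)=\frac1{2\pi i}\int_{\gamma(A)}{}_2F_1\!\left(k+1,1;\alpha+k+1;\frac t\xi\right)\frac{F(\xi)e^{-r\xi}}{\xi}\,d\xi ,$$ where $\gamma(A)$ is oriented counterclockwise and ${}_2F_1$ denotes the principal branch, analytic in $\mathbb C\setminus[1,+\infty)$. (ii) The integrals defining the $f_k^*$ and the sum in (i) converge absolutely, and $F^*(\cdot,\alpha)\in H(a,R)$. -/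

import Mathlib

open MeasureTheory

noncomputable section

namespace FracCalc

/-- The open positive half-line, as a subset of the complex plane. -/
def posRay : Set ℂ := (fun x : ℝ => (x : ℂ)) '' Set.Ioi 0

/-- The region `𝔇(a) = {t : dist (t, (0, +∞)) < a}`. -/
def regionD (a : ℝ) : Set ℂ := {t : ℂ | Metric.infDist t posRay < a}

/-- Arc-length parametrization of the boundary `γ(A)` of `𝔇(A)`, `A > 0`, in the counterclockwise
direction (the region lies on the left): from `+∞ + iA` along the upper half-line to `iA`, along
the left half of the circle `|ξ| = A` to `-iA`, along the lower half-line to `+∞ - iA`. -/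
def gammaPath (A : ℝ) (s : ℝ) : ℂ :=
  if s ≤ 0 then -(s : ℂ) + A * Complex.I
  else if s ≤ Real.pi * A then
    A * Complex.exp (((Real.pi / 2 + s / A : ℝ) : ℂ) * Complex.I)
  else ((s - Real.pi * A : ℝ) : ℂ) - A * Complex.I

/-- The integral `∫_{γ(A)} f(ξ) dξ` converges absolutely. -/
def ContourIntegrable (A : ℝ) (f : ℂ → ℂ) : Prop :=
  Integrable (fun s : ℝ => f (gammaPath A s) * deriv (gammaPath A) s)

/-- The contour integral `∫_{γ(A)} f(ξ) dξ`. -/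
def contourIntegral (A : ℝ) (f : ℂ → ℂ) : ℂ :=
  ∫ s : ℝ, f (gammaPath A s) * deriv (gammaPath A) s

/-- Membership in the space `H(a, R)`. Only the values of `F` on `𝔇(a)` matter. -/
structure MemH (a R : ℝ) (F : ℂ → ℂ) : Prop where
  /-- `F` is analytic in `𝔇(a)`. -/
  analytic : AnalyticOnNhd ℂ F (regionD a)
  /-- `F` has at most exponential growth at infinity, on the regions `𝔇(A)` with `A < a`
  (near the boundary of `𝔇(a)` itself `F` may be unbounded). -/
  growth : ∀ A : ℝ, 0 < A → A < a →
    ∃ C ρ : ℝ, ∀ t ∈ regionD A, ‖F t‖ ≤ C * Real.exp (ρ * ‖t‖)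
  /-- `‖F‖_{r,A} = ∫_{γ(A)} e^{-r|t|} |F(t)| |dt|` is finite for all `r > R`, `0 < A < a`. -/
  norm_finite : ∀ r A : ℝ, R < r → 0 < A → A < a →
    Integrable (fun s : ℝ => Real.exp (-r * ‖gammaPath A s‖) * ‖F (gammaPath A s)‖ *
      ‖deriv (gammaPath A) s‖)

/-- The integrand of the Laplace transform. -/
def laplaceIntegrand (F : ℂ → ℂ) (ζ : ℂ) (t : ℝ) : ℂ := Complex.exp (-ζ * t) * F t

/-- `𝓛{F}(ζ) = ζ ∫_0^∞ e^{-ζt} F(t) dt`. -/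
def laplace (F : ℂ → ℂ) (ζ : ℂ) : ℂ := ζ * ∫ t in Set.Ioi (0 : ℝ), laplaceIntegrand F ζ t

/-- `𝓛_α{F}(ζ) = ζ^α 𝓛{t^α F(t)}(ζ)`. -/
def laplaceAlpha (α : ℂ) (F : ℂ → ℂ) (ζ : ℂ) : ℂ := ζ ^ α * laplace (fun t => t ^ α * F t) ζ

/-- `G = 𝓘_α F = 𝓛_α⁻¹ 𝓛 F` on the level of transforms in the half-plane `Re ζ > R`: there both
transforms converge absolutely, and `𝓛_α G = 𝓛 F`. -/
def IsFracIntegral (R : ℝ) (α : ℂ) (F G : ℂ → ℂ) : Prop :=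
  ∀ ζ : ℂ, R < ζ.re →
    IntegrableOn (laplaceIntegrand F ζ) (Set.Ioi 0) ∧
    IntegrableOn (laplaceIntegrand (fun t => t ^ α * G t) ζ) (Set.Ioi 0) ∧
    laplaceAlpha α G ζ = laplace F ζ

/-- The plane cut along `[1, +∞)`. -/
def cutPlane : Set ℂ := {z : ℂ | 1 - z ∈ Complex.slitPlane}

/-- `g` is the principal branch of Gauss's function `₂F₁(a, b; c; ·)`: the analytic function in the
plane cut along `[1, +∞)` that is given by the hypergeometric series in the unit disc. -/
def IsHypergeometricBranch (a b c : ℂ) (g : ℂ → ℂ) : Prop :=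
  AnalyticOnNhd ℂ g cutPlane ∧
    Set.EqOn g (fun z : ℂ => ordinaryHypergeometric a b c z) (Metric.ball 0 1)

open Classical in
/-- The principal branch of `₂F₁(a, b; c; z)`, for `z` in the plane cut along `[1, +∞)`. -/
def hyp2F1 (a b c z : ℂ) : ℂ :=
  if h : ∃ g : ℂ → ℂ, IsHypergeometricBranch a b c g then h.choose z else 0

/-- The integrand of `f*_k(α, r, t)`, as a function of `ξ`. -/
def coeffIntegrand (F : ℂ → ℂ) (α : ℂ) (r : ℝ) (t : ℂ) (k : ℕ) (ξ : ℂ) : ℂ :=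
  hyp2F1 (k + 1) 1 (α + k + 1) (t / ξ) * (F ξ * Complex.exp (-r * ξ) / ξ)

/-- `f*_k(α, r, t) = (1 / 2πi) ∫_{γ(A)} ₂F₁(k+1, 1; α+k+1; t/ξ) F(ξ) e^{-rξ} / ξ dξ`. -/
def coeff (F : ℂ → ℂ) (A : ℝ) (α : ℂ) (r : ℝ) (t : ℂ) (k : ℕ) : ℂ :=
  1 / (2 * Real.pi * Complex.I) * contourIntegral A (coeffIntegrand F α r t k)

/-- The `k`-th term `(rt)^k f*_k(α, r, t) / Γ(α + k + 1)` of the representation of `𝓘_α F`. -/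
def seriesTerm (F : ℂ → ℂ) (A : ℝ) (α : ℂ) (r : ℝ) (t : ℂ) (k : ℕ) : ℂ :=
  1 / Complex.Gamma (α + k + 1) * (r * t) ^ k * coeff F A α r t k

end FracCalc

end

/-!
The fractional integral is written down explicitly, in a form that makes sense for all `Re α > -1`:
`Γ(α + 1) 𝓘_α F (t) = F(0) + t ∫₀¹ (1 - u)^α F'(ut) du` (`fracInt`). On the positive half-line,
`t^α 𝓘_α F` is `t^α F(0) / Γ(α + 1)` plus the convolution of `t^α / Γ(α + 1)` with `F'`, so that the
convolution theorem, the transform of `t^α` and an integration by parts give `𝓛_α {𝓘_α F} = 𝓛 F`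
(`isFracIntegral_fracInt`). Uniqueness is Fourier inversion on a vertical line together with the
identity theorem (`IsFracIntegral.eqOn`).

The analytic input is Cauchy's formula for `exp (-rξ) F(ξ)` on the unbounded path `γ(A)`
(`MemH.cauchy`). In the region only some exponential bound is available, and `r` may be smaller than
its exponent; a factor `exp (-ε ξ²)` makes the formula available, and as the integral over `γ(A)`
converges absolutely, `ε → 0` is harmless. The formula shows that the members of `H(a, R)` are
exactly the analytic functions bounded by `C exp (r |t|)` on `𝔇(A)` for all `r > R`, `A < a`
(`MemH.exists_bound`, `memH_of_bound`), and this condition passes from `F` to `F'` and to `𝓘_α F`.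

For the series, let `E(ξ) = exp (-rξ) F(ξ)` and expand
`F(ut) = exp (rtu) E(ut) = ∑ (rt)^k / k! · u^k E(ut)` for `0 ≤ u ≤ 1`. Regarded as an operation on
functions of `u`, the fractional integral is `ψ ↦ ψ(0) + ∫₀¹ (1 - u)^α ψ'(u) du`, divided by
`Γ(α + 1)`, and it may be applied term by term (`MemH.hasSum_seriesTerm`). By Cauchy's formula
`u^k E(ut)` is an integral over `ξ ∈ γ(A)` of `u^k / (ξ - ut)`, whose fractional integral is, up to
Gamma factors, `₂F₁(k + 1, 1; α + k + 1; t/ξ) / ξ`; the same formula, as a function of `z = t/ξ`,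
continues the hypergeometric series to the cut plane (`hyp2F1_eq`). Fubini's theorem gives the terms
of the series (`MemH.seriesTerm_eq`): the poles `ut` keep a positive distance from `γ(A)`, because
the region is star-shaped with respect to the origin.
-/

namespace FracCalc

open Set Filter Topology

/-! ### Integrals along the rays from the origin -/

/-- A set that contains with each of its points the segment from the origin to that point. -/
def StarZero (U : Set ℂ) : Prop := ∀ z ∈ U, ∀ u ∈ Icc (0 : ℝ) 1, (u : ℂ) * z ∈ U

theorem StarZero.isPreconnected {U : Set ℂ} (hU : StarZero U) (h0 : 0 ∈ U) :
    IsPreconnected U := by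
  have h : StarConvex ℝ (0 : ℂ) U := by
    rw [starConvex_zero_iff]
    intro x hx a ha ha1
    simpa using hU x hx a ⟨ha, ha1⟩
  exact (h.isPathConnected h0).isConnected.isPreconnected

theorem StarZero.continuousOn_comp_mul {U : Set ℂ} (hU : StarZero U) {G : ℂ → ℂ}
    (hG : ContinuousOn G U) {z : ℂ} (hz : z ∈ U) :
    ContinuousOn (fun u : ℝ => G ((u : ℂ) * z)) (Icc 0 1) := by
  refine hG.comp (by fun_prop) ?_
  intro u hu
  exact hU z hz u hu

theorem StarZero.intervalIntegrable_mul_comp {U : Set ℂ} (hU : StarZero U) {G : ℂ → ℂ}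
    (hG : ContinuousOn G U) {w : ℝ → ℂ} (hw : IntervalIntegrable w volume 0 1) {z : ℂ}
    (hz : z ∈ U) : IntervalIntegrable (fun u : ℝ => w u * G ((u : ℂ) * z)) volume 0 1 := by
  apply hw.mul_continuousOn
  rw [uIcc_of_le zero_le_one]
  exact hU.continuousOn_comp_mul hG hz

/-- Integrals of a holomorphic function along the segments from the origin depend holomorphically
on the end point. This is the source of the holomorphy of `fracInt`, of `hypKernel` and of the
primitives used for Cauchy's formula. -/
theorem StarZero.hasDerivAt_integral {U : Set ℂ} (hU : StarZero U) (hUo : IsOpen U) {G : ℂ → ℂ}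
    (hG : DifferentiableOn ℂ G U) {w : ℝ → ℂ} (hw : IntervalIntegrable w volume 0 1) {z : ℂ}
    (hz : z ∈ U) :
    HasDerivAt (fun z : ℂ => ∫ u in (0 : ℝ)..1, w u * G ((u : ℂ) * z))
      (∫ u in (0 : ℝ)..1, w u * (deriv G ((u : ℂ) * z) * u)) z := by
  obtain ⟨ε, hε, hball⟩ := Metric.nhds_basis_closedBall.mem_iff.1 (hUo.mem_nhds hz)
  have hG' : ContinuousOn (deriv G) U := (hG.deriv hUo).continuousOn
  have hK : IsCompact ((fun p : ℝ × ℂ => (p.1 : ℂ) * p.2) ''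
      (Icc (0 : ℝ) 1 ×ˢ Metric.closedBall z ε)) :=
    (isCompact_Icc.prod (isCompact_closedBall z ε)).image
      ((Complex.continuous_ofReal.comp continuous_fst).mul continuous_snd)
  have hKU : ((fun p : ℝ × ℂ => (p.1 : ℂ) * p.2) ''
      (Icc (0 : ℝ) 1 ×ˢ Metric.closedBall z ε)) ⊆ U := by
    rintro _ ⟨⟨u, x⟩, ⟨hu, hx⟩, rfl⟩
    exact hU x (hball hx) u hu
  obtain ⟨C, hC⟩ := hK.exists_bound_of_continuousOn (hG'.mono hKU)
  refine (intervalIntegral.hasDerivAt_integral_of_dominated_loc_of_deriv_le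
    (F := fun (z : ℂ) (u : ℝ) => w u * G ((u : ℂ) * z))
    (F' := fun (z : ℂ) (u : ℝ) => w u * (deriv G ((u : ℂ) * z) * u)) (bound := fun u => ‖w u‖ * C) (Metric.closedBall_mem_nhds z hε) ?_ ?_ ?_ ?_ ?_ ?_).2
  · filter_upwards [hUo.mem_nhds hz] with x hx
    exact (hU.intervalIntegrable_mul_comp hG.continuousOn hw hx).def'.aestronglyMeasurable
  · exact hU.intervalIntegrable_mul_comp hG.continuousOn hw hz
  · refine (hw.mul_continuousOn (g := fun u : ℝ => deriv G ((u : ℂ) * z) * u)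
      ?_).def'.aestronglyMeasurable
    rw [uIcc_of_le zero_le_one]
    exact (hU.continuousOn_comp_mul hG' hz).mul (by fun_prop)
  · refine Eventually.of_forall fun u hu x hx => ?_
    rw [uIoc_of_le zero_le_one] at hu
    have h1 : ‖deriv G ((u : ℂ) * x)‖ ≤ C := hC _ ⟨(u, x), ⟨⟨hu.1.le, hu.2⟩, hx⟩, rfl⟩
    have h2 : ‖(u : ℂ)‖ ≤ 1 := by
      rw [Complex.norm_real, Real.norm_of_nonneg hu.1.le]; exact hu.2
    rw [norm_mul, norm_mul]
    gcongr
    calc _ ≤ C * 1 := mul_le_mul h1 h2 (norm_nonneg _) ((norm_nonneg _).trans h1)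
      _ = C := mul_one C
  · exact hw.norm.mul_const C
  · refine Eventually.of_forall fun u hu x hx => ?_
    rw [uIoc_of_le zero_le_one] at hu
    have h1 : HasDerivAt G (deriv G ((u : ℂ) * x)) ((u : ℂ) * x) :=
      (hG.differentiableAt (hUo.mem_nhds (hU x (hball hx) u ⟨hu.1.le, hu.2⟩))).hasDerivAt
    have h2 : HasDerivAt (fun x : ℂ => (u : ℂ) * x) u x := by
      simpa using (hasDerivAt_id x).const_mul (u : ℂ)
    exact (h1.comp x h2).const_mul (w u)

/-- A holomorphic function on an open star-shaped set has the primitive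
`z ↦ z ∫₀¹ g(uz) du`. -/
theorem StarZero.exists_primitive {U : Set ℂ} (hU : StarZero U) (hUo : IsOpen U) {g : ℂ → ℂ}
    (hg : DifferentiableOn ℂ g U) : ∃ P : ℂ → ℂ, ∀ z ∈ U, HasDerivAt P (g z) z := by
  refine ⟨fun z => z * ∫ u in (0 : ℝ)..1, (1 : ℂ) * g ((u : ℂ) * z), fun z hz => ?_⟩
  have hw : IntervalIntegrable (fun _ : ℝ => (1 : ℂ)) volume 0 1 := intervalIntegrable_const
  have h := (hasDerivAt_id z).mul (hU.hasDerivAt_integral hUo hg hw hz)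
  refine h.congr_deriv ?_
  have hg' : ContinuousOn (deriv g) U := (hg.deriv hUo).continuousOn
  have hI1 := hU.intervalIntegrable_mul_comp hg.continuousOn hw hz
  have hI2 : IntervalIntegrable (fun u : ℝ => (1 : ℂ) * (deriv g ((u : ℂ) * z) * u)) volume 0 1 := by
    apply hw.mul_continuousOn
    rw [uIcc_of_le zero_le_one]
    exact (hU.continuousOn_comp_mul hg' hz).mul (by fun_prop)
  have hd : ∀ u ∈ uIcc (0 : ℝ) 1, HasDerivAt (fun u : ℝ => (u : ℂ) * g ((u : ℂ) * z))
      (1 * g ((u : ℂ) * z) + z * (1 * (deriv g ((u : ℂ) * z) * u))) u := by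
    intro u hu
    rw [uIcc_of_le zero_le_one] at hu
    have h1 : HasDerivAt g (deriv g ((u : ℂ) * z)) ((u : ℂ) * z) :=
      (hg.differentiableAt (hUo.mem_nhds (hU z hz u hu))).hasDerivAt
    have h2 : HasDerivAt (fun x : ℝ => (x : ℂ)) 1 u := Complex.ofRealCLM.hasDerivAt
    have h3 := h2.mul (h1.comp u (h2.mul_const z))
    refine h3.congr_deriv ?_
    simp only [Function.comp_apply]
    ring
  have := intervalIntegral.integral_eq_sub_of_hasDerivAt hd (hI1.add (hI2.const_mul z))
  rw [intervalIntegral.integral_add hI1 (hI2.const_mul z)] at this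
  simpa [intervalIntegral.integral_const_mul] using this

/-! ### Geometry of the regions and of their boundaries -/

theorem posRay_nonempty : posRay.Nonempty := ⟨1, 1, by simp, by simp⟩

theorem infDist_posRay_le (t : ℂ) {x : ℝ} (hx : 0 ≤ x) : Metric.infDist t posRay ≤ ‖t - x‖ := by
  rw [← Metric.infDist_closure, ← dist_eq_norm]
  apply Metric.infDist_le_dist_of_mem
  have h : x ∈ closure (Ioi (0 : ℝ)) := by rw [closure_Ioi]; exact hx
  exact image_closure_subset_closure_image Complex.continuous_ofReal ⟨x, h, rfl⟩

/-- The region is a union of discs with centres in `[0, +∞)`; unlike in `posRay`, the origin is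
allowed as a centre. -/
theorem mem_regionD_iff {a : ℝ} {t : ℂ} : t ∈ regionD a ↔ ∃ x : ℝ, 0 ≤ x ∧ ‖t - x‖ < a := by
  constructor
  · intro h
    obtain ⟨_, ⟨x, hx, rfl⟩, h⟩ := (Metric.infDist_lt_iff posRay_nonempty).1 h
    exact ⟨x, le_of_lt hx, by rwa [← dist_eq_norm]⟩
  · rintro ⟨x, hx, h⟩
    exact (infDist_posRay_le t hx).trans_lt h

theorem isOpen_regionD (a : ℝ) : IsOpen (regionD a) :=
  isOpen_lt (Metric.continuous_infDist_pt _) continuous_const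

theorem regionD_mono {a b : ℝ} (h : a ≤ b) : regionD a ⊆ regionD b :=
  fun _ ht => lt_of_lt_of_le (show Metric.infDist _ _ < a from ht) h

theorem ofReal_mem_regionD {a x : ℝ} (ha : 0 < a) (hx : 0 ≤ x) : (x : ℂ) ∈ regionD a :=
  mem_regionD_iff.2 ⟨x, hx, by simpa⟩

theorem add_ofReal_mem_regionD {a p : ℝ} {t : ℂ} (ht : t ∈ regionD a) (hp : 0 ≤ p) :
    t + p ∈ regionD a := by
  obtain ⟨x, hx, h⟩ := mem_regionD_iff.1 ht
  exact mem_regionD_iff.2 ⟨x + p, by positivity, by push_cast; convert h using 2; ring⟩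

theorem exists_mem_smaller_regionD {a : ℝ} {t : ℂ} (ht : t ∈ regionD a) (ha : 0 < a) :
    ∃ A, 0 < A ∧ A < a ∧ t ∈ regionD A := by
  have h0 : 0 ≤ Metric.infDist t posRay := Metric.infDist_nonneg
  have h1 : Metric.infDist t posRay < a := ht
  refine ⟨(Metric.infDist t posRay + a) / 2, by linarith, by linarith, ?_⟩
  change Metric.infDist t posRay < _
  linarith

theorem norm_mul_sub_mul_le {t : ℂ} {x : ℝ} {u : ℝ} (hu : u ∈ Icc (0 : ℝ) 1) :
    ‖(u : ℂ) * t - ((u * x : ℝ) : ℂ)‖ ≤ ‖t - x‖ := by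
  have : (u : ℂ) * t - ((u * x : ℝ) : ℂ) = u * (t - x) := by push_cast; ring
  rw [this, norm_mul, Complex.norm_real, Real.norm_of_nonneg hu.1]
  exact mul_le_of_le_one_left (norm_nonneg _) hu.2

theorem starZero_regionD (a : ℝ) : StarZero (regionD a) := by
  intro t ht u hu
  obtain ⟨x, hx, h⟩ := mem_regionD_iff.1 ht
  exact mem_regionD_iff.2 ⟨u * x, mul_nonneg hu.1 hx, (norm_mul_sub_mul_le hu).trans_lt h⟩

theorem isPreconnected_regionD {a : ℝ} (ha : 0 < a) : IsPreconnected (regionD a) :=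
  (starZero_regionD a).isPreconnected (by simpa using ofReal_mem_regionD ha le_rfl)

theorem sub_le_norm_sub_of_notMem {A B : ℝ} {w ξ : ℂ} (hw : w ∈ regionD B)
    (hξ : ξ ∉ regionD A) : A - B ≤ ‖ξ - w‖ := by
  obtain ⟨x, hx, h⟩ := mem_regionD_iff.1 hw
  have h1 : A ≤ ‖ξ - x‖ := by
    by_contra! h2
    exact hξ (mem_regionD_iff.2 ⟨x, hx, h2⟩)
  have h3 : ‖ξ - x‖ ≤ ‖ξ - w‖ + ‖w - x‖ := norm_sub_le_norm_sub_add_norm_sub _ _ _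
  linarith

theorem exists_forall_le_norm_sub {A : ℝ} (hA : 0 < A) {t : ℂ} (ht : t ∈ regionD A) :
    ∃ δ > 0, ∀ ξ ∉ regionD A, ∀ u ∈ Icc (0 : ℝ) 1, δ ≤ ‖ξ - u * t‖ := by
  obtain ⟨B, _, hBA, hB⟩ := exists_mem_smaller_regionD ht hA
  exact ⟨A - B, sub_pos.2 hBA, fun ξ hξ u hu =>
    sub_le_norm_sub_of_notMem (starZero_regionD B t hB u hu) hξ⟩

theorem abs_im_lt_of_mem_regionD {a : ℝ} {t : ℂ} (ht : t ∈ regionD a) : |t.im| < a := by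
  obtain ⟨x, _, h⟩ := mem_regionD_iff.1 ht
  have := Complex.abs_im_le_norm (t - x)
  simp at this
  linarith

theorem norm_le_re_add_of_mem_regionD {a : ℝ} {t : ℂ} (ht : t ∈ regionD a) :
    ‖t‖ ≤ t.re + 2 * a := by
  obtain ⟨x, hx, h⟩ := mem_regionD_iff.1 ht
  have h1 := (abs_le.1 (Complex.abs_re_le_norm (t - x))).1
  have h2 : ‖t‖ ≤ ‖t - x‖ + ‖(x : ℂ)‖ := by simpa using norm_add_le (t - x) (x : ℂ)
  rw [Complex.norm_real, Real.norm_of_nonneg hx] at h2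
  simp at h1
  linarith

section Path

variable {A : ℝ}

theorem gammaPath_of_nonpos {s : ℝ} (hs : s ≤ 0) :
    gammaPath A s = -(s : ℂ) + A * Complex.I := by simp [gammaPath, hs]

theorem gammaPath_of_mem {s : ℝ} (hs : 0 < s) (hs' : s ≤ Real.pi * A) :
    gammaPath A s = A * Complex.exp (((Real.pi / 2 + s / A : ℝ) : ℂ) * Complex.I) := by
  simp [gammaPath, hs.not_ge, hs']

theorem gammaPath_of_gt (hA : 0 < A) {s : ℝ} (hs : Real.pi * A < s) :
    gammaPath A s = ((s - Real.pi * A : ℝ) : ℂ) - A * Complex.I := by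
  have : 0 < s := lt_trans (by positivity) hs
  simp [gammaPath, this.not_ge, hs.not_ge]

theorem continuous_gammaPath (hA : 0 < A) : Continuous (gammaPath A) := by
  unfold gammaPath
  refine Continuous.if_le (by fun_prop) ?_ continuous_id continuous_const ?_
  · refine Continuous.if_le ?_ (by fun_prop) continuous_id continuous_const ?_
    · fun_prop
    · rintro s rfl
      have h : Real.pi / 2 + Real.pi * A / A = Real.pi / 2 + Real.pi := by field_simp
      rw [h]
      push_cast
      rw [add_mul, Complex.exp_add, Complex.exp_pi_mul_I, Complex.exp_pi_div_two_mul_I]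
      ring
  · rintro s rfl
    have : (0 : ℝ) ≤ Real.pi * A := by positivity
    rw [if_pos this]
    simp [Complex.exp_pi_div_two_mul_I]

theorem hasDerivAt_gammaPath_of_neg {s : ℝ} (hs : s < 0) : HasDerivAt (gammaPath A) (-1) s := by
  have h : HasDerivAt (fun s : ℝ => -(s : ℂ) + A * Complex.I) (-1) s :=
    (Complex.ofRealCLM.hasDerivAt.neg).add_const _
  refine h.congr_of_eventuallyEq ?_
  filter_upwards [Iio_mem_nhds hs] with x hx using gammaPath_of_nonpos (le_of_lt hx)

theorem hasDerivAt_gammaPath_of_mem (hA : 0 < A) {s : ℝ} (hs : 0 < s) (hs' : s < Real.pi * A) :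
    HasDerivAt (gammaPath A)
      (Complex.exp (((Real.pi / 2 + s / A : ℝ) : ℂ) * Complex.I) * Complex.I) s := by
  have h0 : HasDerivAt (fun s : ℝ => Real.pi / 2 + s / A) (1 / A) s :=
    ((hasDerivAt_id s).div_const A).const_add _
  have h : HasDerivAt
      (fun s : ℝ => A * Complex.exp (((Real.pi / 2 + s / A : ℝ) : ℂ) * Complex.I))
      (A * (Complex.exp (((Real.pi / 2 + s / A : ℝ) : ℂ) * Complex.I) *
        (((1 / A : ℝ) : ℂ) * Complex.I))) s :=
    ((h0.ofReal_comp.mul_const Complex.I).cexp).const_mul _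
  have hA' : (A : ℂ) ≠ 0 := by exact_mod_cast hA.ne'
  refine (h.congr_of_eventuallyEq ?_).congr_deriv ?_
  · filter_upwards [Ioo_mem_nhds hs hs'] with x hx using gammaPath_of_mem hx.1 hx.2.le
  · push_cast
    field_simp

theorem hasDerivAt_gammaPath_of_gt (hA : 0 < A) {s : ℝ} (hs : Real.pi * A < s) :
    HasDerivAt (gammaPath A) 1 s := by
  have h : HasDerivAt (fun s : ℝ => ((s - Real.pi * A : ℝ) : ℂ) - A * Complex.I) 1 s := by
    simpa using (((hasDerivAt_id s).sub_const (Real.pi * A)).ofReal_comp).sub_const (A * Complex.I)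
  refine h.congr_of_eventuallyEq ?_
  filter_upwards [Ioi_mem_nhds hs] with x hx using gammaPath_of_gt hA hx

/-- The path is differentiable, with unit speed, away from the two points where its pieces meet. -/
theorem exists_hasDerivAt_gammaPath (hA : 0 < A) {s : ℝ} (hs : s ∉ ({0, Real.pi * A} : Set ℝ)) :
    ∃ v : ℂ, HasDerivAt (gammaPath A) v s ∧ ‖v‖ = 1 := by
  simp only [mem_insert_iff, mem_singleton_iff, not_or] at hs
  rcases lt_or_gt_of_ne hs.1 with h | h
  · exact ⟨-1, hasDerivAt_gammaPath_of_neg h, by simp⟩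
  rcases lt_or_gt_of_ne hs.2 with h' | h'
  · refine ⟨_, hasDerivAt_gammaPath_of_mem hA h h', ?_⟩
    rw [norm_mul, Complex.norm_exp_ofReal_mul_I, Complex.norm_I, one_mul]
  · exact ⟨1, hasDerivAt_gammaPath_of_gt hA h', by simp⟩

theorem ae_norm_deriv_gammaPath (hA : 0 < A) : ∀ᵐ s : ℝ, ‖deriv (gammaPath A) s‖ = 1 := by
  have hc : ({0, Real.pi * A} : Set ℝ).Countable := (Set.toFinite _).countable
  filter_upwards [hc.ae_notMem volume] with s hs
  obtain ⟨v, hv, hv1⟩ := exists_hasDerivAt_gammaPath hA hs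
  rw [hv.deriv, hv1]

/-- Every point of the path has distance `A` from a point `x ≥ 0`, and `x` grows with the
parameter. -/
theorem exists_norm_gammaPath_sub (hA : 0 < A) (s : ℝ) :
    ∃ x : ℝ, 0 ≤ x ∧ |s| ≤ x + Real.pi * A ∧ ‖gammaPath A s - x‖ = A := by
  rcases le_or_gt s 0 with h | h
  · refine ⟨-s, by linarith, ?_, ?_⟩
    · rw [abs_of_nonpos h]
      have : 0 < Real.pi * A := by positivity
      linarith
    · rw [gammaPath_of_nonpos h]
      simp [abs_of_pos hA]
  rcases le_or_gt s (Real.pi * A) with h' | h'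
  · refine ⟨0, le_rfl, by rw [abs_of_pos h]; linarith, ?_⟩
    rw [gammaPath_of_mem h h', Complex.ofReal_zero, sub_zero, norm_mul,
      Complex.norm_exp_ofReal_mul_I, Complex.norm_real, Real.norm_of_nonneg hA.le, mul_one]
  · refine ⟨s - Real.pi * A, by linarith, by rw [abs_of_pos h]; linarith, ?_⟩
    rw [gammaPath_of_gt hA h']
    simp [abs_of_pos hA]

theorem gammaPath_mem_regionD (hA : 0 < A) {a : ℝ} (h : A < a) (s : ℝ) :
    gammaPath A s ∈ regionD a := by
  obtain ⟨x, hx, _, h1⟩ := exists_norm_gammaPath_sub hA s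
  exact mem_regionD_iff.2 ⟨x, hx, h1.trans_lt h⟩

/-- The path tends to infinity at unit speed. -/
theorem norm_gammaPath_ge (hA : 0 < A) (s : ℝ) : |s| - (Real.pi + 1) * A ≤ ‖gammaPath A s‖ := by
  obtain ⟨x, hx, h2, h1⟩ := exists_norm_gammaPath_sub hA s
  have h3 : ‖(x : ℂ)‖ ≤ ‖gammaPath A s‖ + ‖gammaPath A s - x‖ := by
    simpa using norm_sub_le (gammaPath A s) (gammaPath A s - x)
  rw [Complex.norm_real, Real.norm_of_nonneg hx] at h3
  linarith

theorem gammaPath_notMem_regionD (hA : 0 < A) (s : ℝ) : gammaPath A s ∉ regionD A := by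
  intro hmem
  obtain ⟨x, hx, h⟩ := mem_regionD_iff.1 hmem
  rcases le_or_gt s 0 with h1 | h1
  · rw [gammaPath_of_nonpos h1] at h hmem
    have := abs_im_lt_of_mem_regionD hmem
    simp [abs_of_pos hA] at this
  rcases le_or_gt s (Real.pi * A) with h' | h'
  · rw [gammaPath_of_mem h1 h'] at h
    set θ : ℝ := Real.pi / 2 + s / A
    have hcos : Real.cos θ ≤ 0 := by
      apply Real.cos_nonpos_of_pi_div_two_le_of_le
      · have : 0 < s / A := by positivity
        simp only [θ]; linarith
      · have : s / A ≤ Real.pi := by rw [div_le_iff₀ hA]; exact h'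
        simp only [θ]; linarith
    have h2 : ‖(A : ℂ) * Complex.exp ((θ : ℂ) * Complex.I) - x‖ ^ 2 < A ^ 2 := by gcongr
    rw [← Complex.normSq_eq_norm_sq, Complex.normSq_apply] at h2
    simp only [Complex.sub_re, Complex.sub_im, Complex.re_ofReal_mul, Complex.im_ofReal_mul,
      Complex.exp_ofReal_mul_I_re, Complex.exp_ofReal_mul_I_im, Complex.ofReal_re,
      Complex.ofReal_im] at h2
    nlinarith [Real.sin_sq_add_cos_sq θ, mul_nonneg hA.le hx, mul_nonneg (mul_nonneg hA.le hx)
      (neg_nonneg.2 hcos), sq_nonneg x]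
  · rw [gammaPath_of_gt hA h'] at hmem
    have := abs_im_lt_of_mem_regionD hmem
    simp [abs_of_pos hA] at this

theorem gammaPath_ne_zero (hA : 0 < A) (s : ℝ) : gammaPath A s ≠ 0 := fun h =>
  gammaPath_notMem_regionD hA s (h ▸ by simpa using ofReal_mem_regionD hA (le_refl 0))

end Path

/-! ### Cauchy's formula on the unbounded regions -/

section Cauchy

variable {A a : ℝ}

theorem ContourIntegrable.bdd_mul {f g : ℂ → ℂ} (hf : ContourIntegrable A f)
    (hg : Continuous fun s => g (gammaPath A s)) {C : ℝ} (hC : ∀ s, ‖g (gammaPath A s)‖ ≤ C) :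
    ContourIntegrable A fun ξ => g ξ * f ξ := by
  have h := Integrable.bdd_mul (c := C) hf hg.aestronglyMeasurable (Eventually.of_forall hC)
  unfold ContourIntegrable
  simpa only [mul_assoc] using h

theorem continuous_inv_gammaPath_sub (hA : 0 < A) {w : ℂ} (hw : w ∈ regionD A) :
    Continuous fun s => (gammaPath A s - w)⁻¹ := by
  refine ((continuous_gammaPath hA).sub continuous_const).inv₀ fun s h => ?_
  have h : gammaPath A s = w := sub_eq_zero.1 h
  exact gammaPath_notMem_regionD hA s (h ▸ hw)

theorem norm_inv_gammaPath_sub_le (hA : 0 < A) {B : ℝ} (hB : B < A) {w : ℂ}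
    (hw : w ∈ regionD B) (s : ℝ) : ‖(gammaPath A s - w)⁻¹‖ ≤ (A - B)⁻¹ := by
  rw [norm_inv]
  exact inv_anti₀ (sub_pos.2 hB)
    (sub_le_norm_sub_of_notMem hw (gammaPath_notMem_regionD hA s))

theorem ContourIntegrable.inv_sub_mul (hA : 0 < A) {f : ℂ → ℂ} (hf : ContourIntegrable A f)
    {w : ℂ} (hw : w ∈ regionD A) : ContourIntegrable A fun ξ => (ξ - w)⁻¹ * f ξ := by
  obtain ⟨B, _, hBA, hB⟩ := exists_mem_smaller_regionD hw hA
  exact hf.bdd_mul (g := fun ξ => (ξ - w)⁻¹) (continuous_inv_gammaPath_sub hA hw)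
    (norm_inv_gammaPath_sub_le hA hBA hB)

/-- The principal logarithm of `w - ξ` jumps by `2πi` between the two ends of the path: this is
the winding number of the path around `w`. -/
theorem tendsto_log_sub {w : ℂ} (hw : w ∈ regionD A) :
    Tendsto (fun X : ℝ => Complex.log (w - (X - A * Complex.I)) -
      Complex.log (w - (X + A * Complex.I))) atTop (𝓝 (2 * Real.pi * Complex.I)) := by
  have him := abs_lt.1 (abs_im_lt_of_mem_regionD hw)
  have hlim : ∀ c : ℂ, Tendsto (fun X : ℝ => Complex.log (1 - c / X)) atTop (𝓝 0) := by
    intro c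
    have h1 : Tendsto (fun X : ℝ => 1 - c / (X : ℂ)) atTop (𝓝 1) := by
      have : Tendsto (fun X : ℝ => c / (X : ℂ)) atTop (𝓝 0) := by
        have h := (tendsto_inv_atTop_zero (𝕜 := ℝ)).ofReal.const_mul c
        simpa [div_eq_mul_inv] using h
      simpa using this.const_sub 1
    have h2 := (continuousAt_clog (x := 1) (by simp)).tendsto.comp h1
    simpa [Function.comp_def] using h2
  have h := ((hlim (w + A * Complex.I)).sub (hlim (w - A * Complex.I))).add_const
    (2 * Real.pi * Complex.I)
  rw [sub_zero, zero_add] at h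
  refine h.congr' ?_
  filter_upwards [eventually_gt_atTop (‖w‖ + A), eventually_gt_atTop 0] with X hX hX0
  have hX0' : (X : ℂ) ≠ 0 := by exact_mod_cast hX0.ne'
  have hfac : ∀ c : ℂ, c.im ≠ 0 →
      Complex.log (X - c) = Real.log X + Complex.log (1 - c / X) := by
    intro c hc
    have h0 : (X : ℂ) - c = X * (1 - c / X) := by field_simp
    rw [h0, Complex.log_ofReal_mul hX0]
    intro h1
    rw [h1, mul_zero] at h0
    apply hc
    have := congrArg Complex.im h0
    simpa using this
  have e1 : w - (X - A * Complex.I) = -(X - (w + A * Complex.I)) := by ring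
  have e2 : w - (X + A * Complex.I) = -(X - (w - A * Complex.I)) := by ring
  have i1 : (w + A * Complex.I).im = w.im + A := by simp
  have i2 : (w - A * Complex.I).im = w.im - A := by simp
  have l1 : Complex.log (w - (X - A * Complex.I)) =
      Complex.log (X - (w + A * Complex.I)) + Real.pi * Complex.I := by
    rw [e1, Complex.log, Complex.log, norm_neg, Complex.arg_neg_eq_arg_add_pi_of_im_neg]
    · push_cast; ring
    · rw [Complex.sub_im, i1, Complex.ofReal_im]; linarith
  have l2 : Complex.log (w - (X + A * Complex.I)) =
      Complex.log (X - (w - A * Complex.I)) - Real.pi * Complex.I := by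
    rw [e2, Complex.log, Complex.log, norm_neg, Complex.arg_neg_eq_arg_sub_pi_of_im_pos]
    · push_cast; ring
    · rw [Complex.sub_im, i2, Complex.ofReal_im]; linarith
  rw [l1, l2, hfac _ (by rw [i1]; linarith), hfac _ (by rw [i2]; linarith)]
  ring

/-- Cauchy's formula for a function that tends to zero along the region. Subtracting the pole
leaves a holomorphic function, which has a primitive on the star-shaped region; the pole itself has
the primitive `log (w - ξ)` along the path, as the path avoids the half-line `w + [0, +∞)`. -/
theorem cauchy_of_decay (hA : 0 < A) (hAa : A < a) {f : ℂ → ℂ}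
    (hf : DifferentiableOn ℂ f (regionD a)) (hint : ContourIntegrable A f)
    {b : ℝ → ℝ} (hb : Tendsto b atTop (𝓝 0))
    (hfb : ∀ X : ℝ, 0 ≤ X → ∀ y : ℝ, |y| ≤ A → ‖f (X + y * Complex.I)‖ ≤ b X)
    {w : ℂ} (hw : w ∈ regionD A) :
    contourIntegral A (fun ξ => (ξ - w)⁻¹ * f ξ) = 2 * Real.pi * Complex.I * f w := by
  have hwa : w ∈ regionD a := regionD_mono hAa.le hw
  have hnhds : regionD a ∈ 𝓝 w := (isOpen_regionD a).mem_nhds hwa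
  obtain ⟨P, hP⟩ := (starZero_regionD a).exists_primitive (isOpen_regionD a)
    ((Complex.differentiableOn_dslope hnhds).2 hf)
  have hne : ∀ s, gammaPath A s ≠ w := fun s h => gammaPath_notMem_regionD hA s (h ▸ hw)
  have hslit : ∀ s, w - gammaPath A s ∈ Complex.slitPlane := by
    intro s
    rw [Complex.mem_slitPlane_iff_not_le_zero]
    intro h
    rw [Complex.le_def] at h
    refine gammaPath_notMem_regionD hA s ?_
    have h2 := add_ofReal_mem_regionD (p := -(w - gammaPath A s).re) hw (by simpa using h.1)
    convert h2 using 1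
    apply Complex.ext
    · simp
    · have := h.2
      simp at this
      simp; linarith
  set Q : ℂ → ℂ := fun ξ => P ξ + f w * Complex.log (w - ξ) with hQ
  have hQd : ∀ s, HasDerivAt Q ((gammaPath A s - w)⁻¹ * f (gammaPath A s)) (gammaPath A s) := by
    intro s
    have h1 := hP _ (gammaPath_mem_regionD hA hAa s)
    have h2 := (((hasDerivAt_id (gammaPath A s)).const_sub w).clog (hslit s)).const_mul (f w)
    refine (h1.add h2).congr_deriv ?_
    rw [dslope_of_ne _ (hne s), slope_def_field]
    have h3 : gammaPath A s - w ≠ 0 := sub_ne_zero.2 (hne s)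
    have h4 : w - gammaPath A s ≠ 0 := sub_ne_zero.2 (hne s).symm
    simp only [id]
    have h5 : (-1 : ℂ) / (w - gammaPath A s) = 1 / (gammaPath A s - w) := by
      rw [← neg_sub (gammaPath A s) w, neg_div_neg_eq]
    rw [h5]
    field_simp
    ring
  have hfin := hint.inv_sub_mul hA hw
  have hFTC : ∀ X : ℝ, 0 < X →
      ∫ s in (-X)..(Real.pi * A + X), (gammaPath A s - w)⁻¹ * f (gammaPath A s) *
        deriv (gammaPath A) s = Q (X - A * Complex.I) - Q (X + A * Complex.I) := by
    intro X hX
    have hc : ({0, Real.pi * A} : Set ℝ).Countable := (Set.toFinite _).countable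
    have hpi : 0 < Real.pi * A := by positivity
    have h := integral_eq_of_hasDerivAt_off_countable (E := ℂ) (Q ∘ gammaPath A)
      (fun s => (gammaPath A s - w)⁻¹ * f (gammaPath A s) * deriv (gammaPath A) s) hc
      (a := -X) (b := Real.pi * A + X)
      (fun s _ => (ContinuousAt.comp (hQd s).continuousAt
        (continuous_gammaPath hA).continuousAt).continuousWithinAt)
      (fun s hs => by
        obtain ⟨v, hv, _⟩ := exists_hasDerivAt_gammaPath hA hs.2
        rw [hv.deriv]
        exact (hQd s).comp s hv)
      hfin.intervalIntegrable
    rw [h, Function.comp_apply, Function.comp_apply, gammaPath_of_gt hA (by linarith),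
      gammaPath_of_nonpos (by linarith)]
    push_cast
    congr 2 <;> ring
  have hlim1 : Tendsto (fun X : ℝ => ∫ s in (-X)..(Real.pi * A + X),
      (gammaPath A s - w)⁻¹ * f (gammaPath A s) * deriv (gammaPath A) s) atTop
      (𝓝 (contourIntegral A (fun ξ => (ξ - w)⁻¹ * f ξ))) :=
    intervalIntegral_tendsto_integral hfin tendsto_neg_atTop_atBot
      (tendsto_atTop_add_const_left _ _ tendsto_id)
  have hPlim : Tendsto (fun X : ℝ => P (X - A * Complex.I) - P (X + A * Complex.I)) atTop
      (𝓝 0) := by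
    have hbd : Tendsto (fun X : ℝ => (b X + ‖f w‖) / (X - ‖w‖) * (2 * A)) atTop (𝓝 0) := by
      have h1 : Tendsto (fun X : ℝ => X - ‖w‖) atTop atTop :=
        tendsto_atTop_add_const_right _ _ tendsto_id
      simpa using ((hb.add_const ‖f w‖).div_atTop h1).mul_const (2 * A)
    refine squeeze_zero_norm' ?_ hbd
    filter_upwards [eventually_gt_atTop ‖w‖, eventually_gt_atTop 0] with X hXw hX0
    set S : Set ℂ := {z | z.re = X ∧ |z.im| ≤ A}
    have hScv : Convex ℝ S := by
      rintro x ⟨hx1, hx2⟩ y ⟨hy1, hy2⟩ c d hc hd hcd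
      refine ⟨?_, ?_⟩
      · simp [hx1, hy1, ← add_mul, hcd]
      · rw [abs_le] at *
        simp only [Complex.add_im, Complex.smul_im, smul_eq_mul]
        constructor <;> nlinarith
    have hSD : S ⊆ regionD a := by
      rintro z ⟨hz1, hz2⟩
      refine mem_regionD_iff.2 ⟨X, hX0.le, ?_⟩
      have : z - X = z.im * Complex.I := by
        apply Complex.ext <;> simp [hz1]
      rw [this, norm_mul, Complex.norm_I, mul_one, Complex.norm_real]
      exact lt_of_le_of_lt hz2 hAa
    have hSb : ∀ z ∈ S, ‖dslope f w z‖ ≤ (b X + ‖f w‖) / (X - ‖w‖) := by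
      rintro z ⟨hz1, hz2⟩
      have hz : z = X + z.im * Complex.I := by
        apply Complex.ext <;> simp [hz1]
      have hXz : X ≤ ‖z‖ := by
        rw [← hz1]; exact Complex.re_le_norm z
      have hzw : X - ‖w‖ ≤ ‖z - w‖ := by
        have := norm_sub_norm_le z w
        linarith
      have hzw' : z ≠ w := by
        rintro rfl
        linarith
      rw [dslope_of_ne _ hzw', slope_def_field, norm_div]
      have h0 : ‖f z - f w‖ ≤ b X + ‖f w‖ := by
        refine (norm_sub_le _ _).trans ?_
        have := hfb X hX0.le z.im hz2
        rw [← hz] at this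
        linarith
      exact div_le_div₀ ((norm_nonneg _).trans h0) h0 (sub_pos.2 hXw) hzw
    have := hScv.norm_image_sub_le_of_norm_hasDerivWithin_le (f := P)
      (fun z hz => (hP z (hSD hz)).hasDerivWithinAt) hSb
      (x := X + A * Complex.I) (y := X - A * Complex.I)
      (by simp [S, abs_of_pos hA]) (by simp [S, abs_of_pos hA])
    refine this.trans_eq ?_
    congr 1
    have : (X - A * Complex.I - (X + A * Complex.I) : ℂ) = ((-(2 * A) : ℝ) : ℂ) * Complex.I := by
      push_cast; ring
    rw [this, norm_mul, Complex.norm_I, mul_one, Complex.norm_real, norm_neg,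
      Real.norm_of_nonneg (by positivity)]
  have hlim2 := hPlim.add ((tendsto_log_sub hw).const_mul (f w))
  refine tendsto_nhds_unique hlim1 ?_
  rw [zero_add, mul_comm (f w)] at hlim2
  refine hlim2.congr' ?_
  filter_upwards [eventually_gt_atTop 0] with X hX
  rw [hFTC X hX, hQ]
  ring

theorem abs_im_gammaPath_le (hA : 0 < A) (s : ℝ) : |(gammaPath A s).im| ≤ A := by
  obtain ⟨x, _, _, h⟩ := exists_norm_gammaPath_sub hA s
  have := Complex.abs_im_le_norm (gammaPath A s - x)
  rw [h] at this
  simpa using this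

theorem sq_sub_sq_le_re_sq {z : ℂ} (h : |z.im| ≤ A) : z.re ^ 2 - A ^ 2 ≤ (z ^ 2).re := by
  have : (z ^ 2).re = z.re ^ 2 - z.im ^ 2 := by
    rw [pow_two, Complex.mul_re]; ring
  rw [this]
  have := sq_le_sq' (abs_le.1 h).1 (abs_le.1 h).2
  linarith

/-- Cauchy's formula under an arbitrary exponential bound inside the region and absolute
convergence on its boundary. The factor `exp (-ε ξ²)` forces decay, and dominated convergence on the
boundary permits `ε → 0`. -/
theorem cauchy_of_growth (hA : 0 < A) {B : ℝ} (hAB : A < B) (hBa : B ≤ a) {f : ℂ → ℂ}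
    (hf : DifferentiableOn ℂ f (regionD a)) (hint : ContourIntegrable A f) {C ρ : ℝ}
    (hfC : ∀ t ∈ regionD B, ‖f t‖ ≤ C * Real.exp (ρ * ‖t‖)) {w : ℂ} (hw : w ∈ regionD A) :
    contourIntegral A (fun ξ => (ξ - w)⁻¹ * f ξ) = 2 * Real.pi * Complex.I * f w := by
  set e : ℝ → ℂ → ℂ := fun ε ξ => Complex.exp (-(ε * ξ ^ 2)) with he
  have hnorm : ∀ ε ξ, ‖e ε ξ‖ = Real.exp (-(ε * (ξ ^ 2).re)) := by
    intro ε ξ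
    rw [he, Complex.norm_exp, Complex.neg_re, Complex.re_ofReal_mul]
  have hbd : ∀ ε, 0 ≤ ε → ∀ s, ‖e ε (gammaPath A s)‖ ≤ Real.exp (ε * A ^ 2) := by
    intro ε hε s
    rw [hnorm]
    apply Real.exp_le_exp.2
    nlinarith [sq_sub_sq_le_re_sq (abs_im_gammaPath_le hA s), sq_nonneg (gammaPath A s).re]
  have hcont : ∀ ε, Continuous fun s => e ε (gammaPath A s) := by
    intro ε
    have := continuous_gammaPath hA
    simp only [he]
    fun_prop
  have key : ∀ ε : ℝ, 0 < ε → contourIntegral A (fun ξ => (ξ - w)⁻¹ * (e ε ξ * f ξ)) =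
      2 * Real.pi * Complex.I * (e ε w * f w) := by
    intro ε hε
    refine cauchy_of_decay (f := fun ξ => e ε ξ * f ξ) hA (hAB.trans_le hBa)
      (DifferentiableOn.mul (by simp only [he]; fun_prop) hf)
      (hint.bdd_mul (hcont ε) (hbd ε hε.le))
      (b := fun X => |C| * Real.exp (|ρ| * A + ε * A ^ 2) * Real.exp (-(X * (ε * X - |ρ|)))) ?_ ?_ hw
    · have h1 : Tendsto (fun X : ℝ => X * (ε * X - |ρ|)) atTop atTop := by
        apply tendsto_id.atTop_mul_atTop₀
        exact tendsto_atTop_add_const_right _ _ (tendsto_id.const_mul_atTop hε)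
      simpa using ((Real.tendsto_exp_neg_atTop_nhds_zero).comp h1).const_mul
        (|C| * Real.exp (|ρ| * A + ε * A ^ 2))
    · intro X hX y hy
      have hmem : (X + y * Complex.I : ℂ) ∈ regionD B := by
        refine mem_regionD_iff.2 ⟨X, hX, ?_⟩
        rw [add_sub_cancel_left, norm_mul, Complex.norm_I, mul_one, Complex.norm_real]
        exact lt_of_le_of_lt hy hAB
      have h1 := hfC _ hmem
      have h2 : ‖(X + y * Complex.I : ℂ)‖ ≤ X + A := by
        refine (norm_add_le _ _).trans ?_
        rw [norm_mul, Complex.norm_I, mul_one, Complex.norm_real, Complex.norm_real,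
          Real.norm_of_nonneg hX]
        exact add_le_add_right hy X
      have h3 : ρ * ‖(X + y * Complex.I : ℂ)‖ ≤ |ρ| * (X + A) :=
        mul_le_mul (le_abs_self _) h2 (norm_nonneg _) (abs_nonneg _)
      have h4 : X ^ 2 - A ^ 2 ≤ (((X + y * Complex.I : ℂ)) ^ 2).re := by
        have := sq_sub_sq_le_re_sq (A := A) (z := (X + y * Complex.I : ℂ)) (by simpa using hy)
        simpa using this
      rw [norm_mul, hnorm]
      calc _ ≤ Real.exp (-(ε * (X ^ 2 - A ^ 2))) * (|C| * Real.exp (|ρ| * (X + A))) := by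
            apply mul_le_mul _ _ (norm_nonneg _) (Real.exp_pos _).le
            · apply Real.exp_le_exp.2
              nlinarith
            · exact h1.trans (mul_le_mul (le_abs_self _) (Real.exp_le_exp.2 h3)
                (Real.exp_pos _).le (abs_nonneg _))
        _ = _ := by
            rw [mul_left_comm, mul_assoc, ← Real.exp_add, ← Real.exp_add]
            congr 2
            ring
  have hne : Tendsto (fun n : ℕ => 1 / ((n : ℝ) + 1)) atTop (𝓝 0) :=
    tendsto_one_div_add_atTop_nhds_zero_nat
  have hepos : ∀ n : ℕ, 0 < 1 / ((n : ℝ) + 1) := fun n => by positivity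
  have hele : ∀ n : ℕ, 1 / ((n : ℝ) + 1) ≤ 1 := fun n => by
    rw [div_le_one (by positivity)]; linarith [(Nat.cast_nonneg n : (0 : ℝ) ≤ n)]
  have helim : ∀ ξ : ℂ, Tendsto (fun n : ℕ => e (1 / ((n : ℝ) + 1)) ξ) atTop (𝓝 1) := by
    intro ξ
    have hc : Continuous fun ε : ℝ => e ε ξ := by simp only [he]; fun_prop
    have := (hc.tendsto 0).comp hne
    simpa [he, Function.comp_def] using this
  have hint' := hint.inv_sub_mul hA hw
  have hL : Tendsto (fun n : ℕ => contourIntegral A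
      (fun ξ => (ξ - w)⁻¹ * (e (1 / ((n : ℝ) + 1)) ξ * f ξ))) atTop
      (𝓝 (contourIntegral A (fun ξ => (ξ - w)⁻¹ * f ξ))) := by
    refine tendsto_integral_of_dominated_convergence
      (fun s => Real.exp (A ^ 2) * ‖(gammaPath A s - w)⁻¹ * f (gammaPath A s) *
        deriv (gammaPath A) s‖) ?_ (hint'.norm.const_mul _) ?_ ?_
    · intro n
      exact ((hint.bdd_mul (hcont _) (hbd _ (hepos n).le)).inv_sub_mul hA hw).aestronglyMeasurable
    · intro n
      refine Eventually.of_forall fun s => ?_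
      have h1 : ‖e (1 / ((n : ℝ) + 1)) (gammaPath A s)‖ ≤ Real.exp (A ^ 2) := by
        refine (hbd _ (hepos n).le s).trans (Real.exp_le_exp.2 ?_)
        exact mul_le_of_le_one_left (sq_nonneg A) (hele n)
      calc _ = ‖e (1 / ((n : ℝ) + 1)) (gammaPath A s)‖ * ‖(gammaPath A s - w)⁻¹ *
            f (gammaPath A s) * deriv (gammaPath A) s‖ := by
            rw [← norm_mul]; congr 1; ring
        _ ≤ _ := mul_le_mul_of_nonneg_right h1 (norm_nonneg _)
    · refine Eventually.of_forall fun s => ?_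
      have := (((helim (gammaPath A s)).mul_const (f (gammaPath A s))).const_mul
        ((gammaPath A s - w)⁻¹)).mul_const (deriv (gammaPath A) s)
      simpa using this
  refine tendsto_nhds_unique hL ?_
  simp_rw [fun n : ℕ => key _ (hepos n)]
  simpa using ((helim w).mul_const (f w)).const_mul (2 * Real.pi * Complex.I)

/-- Differentiation of Cauchy's formula with respect to the pole. -/
theorem hasDerivAt_contourIntegral (hA : 0 < A) {f : ℂ → ℂ} (hint : ContourIntegrable A f)
    {w : ℂ} (hw : w ∈ regionD A) :
    HasDerivAt (fun w => contourIntegral A fun ξ => (ξ - w)⁻¹ * f ξ)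
      (contourIntegral A fun ξ => (ξ - w)⁻¹ * ((ξ - w)⁻¹ * f ξ)) w := by
  obtain ⟨B, _, hBA, hB⟩ := exists_mem_smaller_regionD hw hA
  have hnh : regionD B ∈ 𝓝 w := (isOpen_regionD B).mem_nhds hB
  refine (hasDerivAt_integral_of_dominated_loc_of_deriv_le
    (F := fun w s => (gammaPath A s - w)⁻¹ * f (gammaPath A s) * deriv (gammaPath A) s)
    (F' := fun w s => (gammaPath A s - w)⁻¹ * ((gammaPath A s - w)⁻¹ * f (gammaPath A s)) *
      deriv (gammaPath A) s)
    (bound := fun s => (A - B)⁻¹ * (A - B)⁻¹ * ‖f (gammaPath A s) * deriv (gammaPath A) s‖)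
    hnh ?_ ?_ ?_ ?_ ?_ ?_).2
  · filter_upwards [hnh] with x hx
    exact (hint.inv_sub_mul hA (regionD_mono hBA.le hx)).aestronglyMeasurable
  · exact hint.inv_sub_mul hA hw
  · exact ((hint.inv_sub_mul hA hw).inv_sub_mul hA hw).aestronglyMeasurable
  · refine Eventually.of_forall fun s x hx => ?_
    have h := norm_inv_gammaPath_sub_le hA hBA hx s
    have e : (gammaPath A s - x)⁻¹ * ((gammaPath A s - x)⁻¹ * f (gammaPath A s)) *
      deriv (gammaPath A) s = (gammaPath A s - x)⁻¹ * (gammaPath A s - x)⁻¹ *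
        (f (gammaPath A s) * deriv (gammaPath A) s) := by ring
    rw [e, norm_mul, norm_mul (gammaPath A s - x)⁻¹]
    gcongr
  · exact (Integrable.norm hint).const_mul _
  · refine Eventually.of_forall fun s x hx => ?_
    have hne : gammaPath A s - x ≠ 0 := fun h => gammaPath_notMem_regionD hA s
      (sub_eq_zero.1 h ▸ regionD_mono hBA.le hx)
    have h := (((hasDerivAt_id x).const_sub (gammaPath A s)).inv hne).mul_const
      (f (gammaPath A s)) |>.mul_const (deriv (gammaPath A) s)
    refine h.congr_deriv ?_
    simp only [id, neg_neg]
    field_simp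

end Cauchy

/-! ### Pointwise bounds for the members of `H(a, R)` -/

section Bounds

theorem integrable_exp_neg_mul_abs {b : ℝ} (hb : 0 < b) :
    Integrable fun s : ℝ => Real.exp (-b * |s|) := by
  rw [← integrableOn_univ, ← Iic_union_Ioi (a := (0 : ℝ))]
  refine IntegrableOn.union ?_ ?_
  · refine (integrableOn_exp_mul_Iic hb 0).congr_fun (fun s hs => ?_) measurableSet_Iic
    simp only
    rw [abs_of_nonpos hs]
    congr 1; ring
  · refine (integrableOn_exp_mul_Ioi (neg_lt_zero.2 hb) 0).congr_fun (fun s hs => ?_)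
      measurableSet_Ioi
    simp only
    rw [abs_of_pos hs]

/-- A function is in `H(a, R)` if it is bounded by `C exp (r |t|)` on each smaller region, for all
`r > R`. -/
theorem memH_of_bound {a R : ℝ} {F : ℂ → ℂ} (hF : AnalyticOnNhd ℂ F (regionD a))
    (hb : ∀ r A : ℝ, R < r → 0 < A → A < a → ∃ C, ∀ t ∈ regionD A,
      ‖F t‖ ≤ C * Real.exp (r * ‖t‖)) : MemH a R F := by
  refine ⟨hF, fun A hA hAa => ?_, fun r A hr hA hAa => ?_⟩
  · obtain ⟨C, hC⟩ := hb (R + 1) A (by linarith) hA hAa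
    exact ⟨C, R + 1, hC⟩
  · obtain ⟨C, hC⟩ := hb ((R + r) / 2) ((A + a) / 2) (by linarith) (by linarith) (by linarith)
    set b := (r - R) / 2 with hbdef
    have hb0 : 0 < b := by simp only [hbdef]; linarith
    refine ((integrable_exp_neg_mul_abs hb0).const_mul
      (C * Real.exp (b * ((Real.pi + 1) * A)))).mono' ?_ ?_
    · refine AEStronglyMeasurable.mul ?_ (measurable_deriv _).norm.aestronglyMeasurable
      refine Continuous.aestronglyMeasurable ?_
      have hc := continuous_gammaPath hA
      refine Continuous.mul (by fun_prop) ?_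
      exact (hF.continuousOn.comp_continuous hc (gammaPath_mem_regionD hA hAa)).norm
    · filter_upwards [ae_norm_deriv_gammaPath hA] with s hs
      have hCs := hC _ (gammaPath_mem_regionD hA (by linarith) s)
      have hC0 : 0 ≤ C := by
        by_contra! h
        have := mul_neg_of_neg_of_pos h (Real.exp_pos ((R + r) / 2 * ‖gammaPath A s‖))
        linarith [norm_nonneg (F (gammaPath A s))]
      rw [hs, mul_one, norm_mul, norm_norm, Real.norm_of_nonneg (Real.exp_pos _).le]
      calc _ ≤ Real.exp (-r * ‖gammaPath A s‖) * (C * Real.exp ((R + r) / 2 * ‖gammaPath A s‖)) := by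
            gcongr
        _ = C * Real.exp (-b * ‖gammaPath A s‖) := by
            rw [mul_left_comm, ← Real.exp_add]
            congr 2
            simp only [hbdef]; ring
        _ ≤ C * Real.exp (b * ((Real.pi + 1) * A) + -b * |s|) := by
            gcongr
            nlinarith [norm_gammaPath_ge hA s]
        _ = _ := by rw [Real.exp_add]; ring

variable {a R : ℝ} {F : ℂ → ℂ}

theorem MemH.differentiableOn (hF : MemH a R F) : DifferentiableOn ℂ F (regionD a) :=
  hF.analytic.differentiableOn

theorem MemH.contourIntegrable_exp_mul (hF : MemH a R F) (hR : 0 ≤ R) {r A : ℝ} (hr : R < r)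
    (hA : 0 < A) (hAa : A < a) : ContourIntegrable A fun ξ => Complex.exp (-r * ξ) * F ξ := by
  have hc := continuous_gammaPath hA
  have hFc := hF.analytic.continuousOn.comp_continuous hc (gammaPath_mem_regionD hA hAa)
  refine ((hF.norm_finite r A hr hA hAa).const_mul (Real.exp (2 * r * ((A + a) / 2) +
    2 * r * ((A + a) / 2)))).mono' ?_ ?_
  · refine AEStronglyMeasurable.mul ?_ (measurable_deriv _).aestronglyMeasurable
    exact (Continuous.mul (by fun_prop) hFc).aestronglyMeasurable
  · refine Eventually.of_forall fun s => ?_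
    have h := norm_le_re_add_of_mem_regionD
      (gammaPath_mem_regionD hA (show A < (A + a) / 2 by linarith) s)
    have hr0 : 0 < r := by linarith
    rw [norm_mul, norm_mul, Complex.norm_exp, ← mul_assoc, ← mul_assoc, ← Real.exp_add]
    gcongr
    have : (-(r : ℂ) * gammaPath A s).re = -(r * (gammaPath A s).re) := by
      rw [neg_mul, Complex.neg_re, Complex.re_ofReal_mul]
    rw [this]
    have h2 : 0 < r * ((A + a) / 2) := by apply mul_pos hr0; linarith
    nlinarith

/-- Cauchy's formula for `exp (-rξ) F(ξ)`. -/
theorem MemH.cauchy (hF : MemH a R F) (hR : 0 ≤ R) {r A : ℝ} (hr : R < r)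
    (hA : 0 < A) (hAa : A < a) {w : ℂ} (hw : w ∈ regionD A) :
    contourIntegral A (fun ξ => (ξ - w)⁻¹ * (Complex.exp (-r * ξ) * F ξ)) =
      2 * Real.pi * Complex.I * (Complex.exp (-r * w) * F w) := by
  obtain ⟨C, ρ, hC⟩ := hF.growth ((A + a) / 2) (by linarith) (by linarith)
  refine cauchy_of_growth (B := (A + a) / 2) (a := a) (C := C) (ρ := |r| + ρ) hA (by linarith)
    (by linarith) (f := fun ξ => Complex.exp (-r * ξ) * F ξ)
    (DifferentiableOn.mul (by fun_prop) hF.differentiableOn)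
    (hF.contourIntegrable_exp_mul hR hr hA hAa) (fun t ht => ?_) hw
  rw [norm_mul, add_mul, Real.exp_add, mul_left_comm]
  gcongr
  · rw [Complex.norm_exp]
    apply Real.exp_le_exp.2
    refine (Complex.re_le_norm _).trans ?_
    rw [norm_mul, norm_neg, Complex.norm_real, Real.norm_eq_abs]
  · exact hC t ht

theorem MemH.cauchy_deriv (hF : MemH a R F) (hR : 0 ≤ R) {r A : ℝ} (hr : R < r)
    (hA : 0 < A) (hAa : A < a) {w : ℂ} (hw : w ∈ regionD A) :
    contourIntegral A (fun ξ => (ξ - w)⁻¹ * ((ξ - w)⁻¹ * (Complex.exp (-r * ξ) * F ξ))) =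
      2 * Real.pi * Complex.I * deriv (fun w => Complex.exp (-r * w) * F w) w := by
  have h1 := hasDerivAt_contourIntegral hA (hF.contourIntegrable_exp_mul hR hr hA hAa) hw
  have hd : DifferentiableAt ℂ (fun w => Complex.exp (-r * w) * F w) w :=
    DifferentiableAt.mul (by fun_prop) (hF.differentiableOn.differentiableAt
      ((isOpen_regionD a).mem_nhds (regionD_mono hAa.le hw)))
  have h2 := (hd.hasDerivAt.const_mul (2 * Real.pi * Complex.I : ℂ)).congr_of_eventuallyEq
    (f₁ := fun w => contourIntegral A fun ξ => (ξ - w)⁻¹ * (Complex.exp (-r * ξ) * F ξ)) (by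
      filter_upwards [(isOpen_regionD A).mem_nhds hw] with x hx
      exact hF.cauchy hR hr hA hAa hx)
  exact h1.unique h2

/-- The members of `H(a, R)` are bounded by `C exp (r |t|)` for every `r > R`, whatever the
exponent in their growth condition is. -/
theorem MemH.exists_bound (hF : MemH a R F) (hR : 0 ≤ R) {r A : ℝ} (hr : R < r)
    (hA : 0 < A) (hAa : A < a) :
    ∃ C, 0 ≤ C ∧ ∀ t ∈ regionD A, ‖F t‖ ≤ C * Real.exp (r * ‖t‖) := by
  set B := (A + a) / 2 with hB
  have hAB : A < B := by simp only [hB]; linarith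
  have hBa : B < a := by simp only [hB]; linarith
  have hB0 : 0 < B := hA.trans hAB
  set M : ℝ := ∫ s : ℝ, ‖Complex.exp (-r * gammaPath B s) * F (gammaPath B s) *
    deriv (gammaPath B) s‖
  have hM0 : 0 ≤ M := integral_nonneg fun _ => norm_nonneg _
  have hBA0 : 0 ≤ (B - A)⁻¹ := inv_nonneg.2 (by linarith)
  refine ⟨(B - A)⁻¹ * M, by positivity, fun t ht => ?_⟩
  have hint := hF.contourIntegrable_exp_mul hR hr hB0 hBa
  have h1 := hF.cauchy hR hr hB0 hBa (regionD_mono hAB.le ht)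
  have h2 : ‖contourIntegral B (fun ξ => (ξ - t)⁻¹ * (Complex.exp (-r * ξ) * F ξ))‖ ≤
      (B - A)⁻¹ * M := by
    rw [contourIntegral, ← integral_const_mul]
    refine norm_integral_le_of_norm_le ((Integrable.norm hint).const_mul _)
      (Eventually.of_forall fun s => ?_)
    rw [mul_assoc, norm_mul]
    exact mul_le_mul_of_nonneg_right (norm_inv_gammaPath_sub_le hB0 hAB ht s) (norm_nonneg _)
  have hpi : 1 ≤ ‖(2 * Real.pi * Complex.I : ℂ)‖ := by
    rw [norm_mul, Complex.norm_I, mul_one, norm_mul, Complex.norm_real,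
      Real.norm_of_nonneg Real.pi_pos.le]
    norm_num
    linarith [Real.pi_gt_three]
  have h3 : ‖Complex.exp (-r * t) * F t‖ ≤ (B - A)⁻¹ * M := by
    refine le_trans ?_ h2
    rw [h1, norm_mul (2 * Real.pi * Complex.I : ℂ)]
    exact le_mul_of_one_le_left (norm_nonneg _) hpi
  have h4 : F t = Complex.exp (r * t) * (Complex.exp (-r * t) * F t) := by
    rw [← mul_assoc, ← Complex.exp_add]; simp
  rw [h4, norm_mul, mul_comm]
  gcongr
  rw [Complex.norm_exp]
  apply Real.exp_le_exp.2
  rw [Complex.re_ofReal_mul]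
  exact mul_le_mul_of_nonneg_left (Complex.re_le_norm _) (by linarith)

theorem MemH.exists_bound_deriv (hF : MemH a R F) (hR : 0 ≤ R) {r A : ℝ} (hr : R < r)
    (hA : 0 < A) (hAa : A < a) :
    ∃ C, 0 ≤ C ∧ ∀ t ∈ regionD A, ‖deriv F t‖ ≤ C * Real.exp (r * ‖t‖) := by
  obtain ⟨C, hC0, hC⟩ := hF.exists_bound hR hr (A := (A + a) / 2) (by linarith) (by linarith)
  set ρ := (a - A) / 4 with hρ
  have hρ0 : 0 < ρ := by simp only [hρ]; linarith
  have hr0 : 0 < r := by linarith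
  refine ⟨C * Real.exp (r * ρ) / ρ, by positivity, fun t ht => ?_⟩
  have hsub : ∀ z ∈ Metric.closedBall t ρ, z ∈ regionD ((A + a) / 2) := by
    intro z hz
    obtain ⟨x, hx, h⟩ := mem_regionD_iff.1 ht
    rw [Metric.mem_closedBall, dist_eq_norm] at hz
    refine mem_regionD_iff.2 ⟨x, hx, ?_⟩
    have : ‖z - x‖ ≤ ‖z - t‖ + ‖t - x‖ := norm_sub_le_norm_sub_add_norm_sub _ _ _
    simp only [hρ] at hz
    linarith
  have hd : DiffContOnCl ℂ F (Metric.ball t ρ) := by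
    refine (hF.differentiableOn.mono fun z hz => ?_).diffContOnCl
    rw [closure_ball _ hρ0.ne'] at hz
    exact regionD_mono (by linarith) (hsub z hz)
  refine (Complex.norm_deriv_le_of_forall_mem_sphere_norm_le hρ0 hd
    (C := C * Real.exp (r * ρ) * Real.exp (r * ‖t‖)) fun z hz => ?_).trans_eq (by ring)
  have hz' := Metric.sphere_subset_closedBall hz
  refine (hC z (hsub z hz')).trans ?_
  rw [mul_assoc, ← Real.exp_add]
  gcongr
  rw [Metric.mem_closedBall, dist_eq_norm] at hz'
  have : ‖z‖ ≤ ‖z - t‖ + ‖t‖ := by simpa using norm_add_le (z - t) t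
  nlinarith

end Bounds

/-! ### The fractional integral and its Laplace transform -/

section Transform

theorem intervalIntegrable_one_sub_cpow {α : ℂ} (hα : -1 < α.re) :
    IntervalIntegrable (fun u : ℝ => ((1 - u : ℝ) : ℂ) ^ α) volume 0 1 := by
  have h := (intervalIntegral.intervalIntegrable_cpow' (a := 0) (b := 1) hα).comp_sub_left 1
  simpa using h.symm

theorem Gamma_add_ne_zero {α : ℂ} (hα : -1 < α.re) (k : ℕ) : Complex.Gamma (α + k + 1) ≠ 0 := by
  apply Complex.Gamma_ne_zero_of_re_pos
  have : (0 : ℝ) ≤ k := Nat.cast_nonneg k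
  simp
  linarith

theorem Gamma_add_one_ne_zero {α : ℂ} (hα : -1 < α.re) : Complex.Gamma (α + 1) ≠ 0 := by
  simpa using Gamma_add_ne_zero hα 0

/-- The fractional integral `𝓘_α F`, in a form that is valid for all `α` with `Re α > -1`:
`Γ(α + 1) 𝓘_α F (t) = F(0) + t ∫₀¹ (1 - u)^α F'(ut) du`. An integration by parts turns it into
the Riemann–Liouville integral of order `α`, divided by `t^α`, if `Re α > 0`. -/
noncomputable def fracInt (α : ℂ) (F : ℂ → ℂ) (t : ℂ) : ℂ :=
  (F 0 + t * ∫ u in (0 : ℝ)..1, ((1 - u : ℝ) : ℂ) ^ α * deriv F (u * t)) / Complex.Gamma (α + 1)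

variable {a R : ℝ} {α : ℂ} {F : ℂ → ℂ}

theorem differentiableOn_fracInt (hα : -1 < α.re) (hF : DifferentiableOn ℂ F (regionD a)) :
    DifferentiableOn ℂ (fracInt α F) (regionD a) := by
  intro t ht
  have h := (starZero_regionD a).hasDerivAt_integral (isOpen_regionD a)
    (hF.deriv (isOpen_regionD a)) (intervalIntegrable_one_sub_cpow hα) ht
  exact (((differentiableAt_id.mul h.differentiableAt).const_add (F 0)).div_const
    _).differentiableWithinAt

theorem memH_fracInt (hR : 0 ≤ R) (hα : -1 < α.re) (hF : MemH a R F) :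
    MemH a R (fracInt α F) := by
  refine memH_of_bound ((differentiableOn_fracInt hα hF.differentiableOn).analyticOnNhd
    (isOpen_regionD a)) fun r A hr hA hAa => ?_
  set q := (R + r) / 2 with hq
  have hRq : R < q := by simp only [hq]; linarith
  have hqr : q < r := by simp only [hq]; linarith
  have hq0 : 0 < q := by linarith
  obtain ⟨C, hC0, hC⟩ := hF.exists_bound_deriv hR hRq hA hAa
  set W : ℝ := ∫ u in (0 : ℝ)..1, ‖((1 - u : ℝ) : ℂ) ^ α‖ with hW
  have hW0 : 0 ≤ W := intervalIntegral.integral_nonneg zero_le_one fun _ _ => norm_nonneg _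
  refine ⟨(‖F 0‖ + (r - q)⁻¹ * (W * C)) / ‖Complex.Gamma (α + 1)‖, fun t ht => ?_⟩
  have h1 : ‖∫ u in (0 : ℝ)..1, ((1 - u : ℝ) : ℂ) ^ α * deriv F (u * t)‖ ≤
      W * (C * Real.exp (q * ‖t‖)) := by
    rw [hW, ← intervalIntegral.integral_mul_const]
    refine intervalIntegral.norm_integral_le_of_norm_le zero_le_one
      (Eventually.of_forall fun u hu => ?_)
      ((intervalIntegrable_one_sub_cpow hα).norm.mul_const _)
    rw [norm_mul]
    gcongr
    refine (hC _ (starZero_regionD A t ht u ⟨hu.1.le, hu.2⟩)).trans ?_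
    gcongr
    rw [norm_mul, Complex.norm_real, Real.norm_of_nonneg hu.1.le]
    exact mul_le_of_le_one_left (norm_nonneg _) hu.2
  -- the factor `|t|` is absorbed by the passage from the exponent `q` to the larger `r`
  have h2 : ‖t‖ ≤ (r - q)⁻¹ * Real.exp ((r - q) * ‖t‖) := by
    rw [inv_mul_eq_div, le_div_iff₀ (by linarith)]
    have := Real.add_one_le_exp ((r - q) * ‖t‖)
    linarith
  have h3 : 1 ≤ Real.exp (r * ‖t‖) := by
    apply Real.one_le_exp
    have : 0 < r := by linarith
    positivity
  rw [fracInt, norm_div, div_mul_eq_mul_div]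
  gcongr
  refine (norm_add_le _ _).trans ?_
  rw [norm_mul, add_mul]
  have hrq : 0 < (r - q)⁻¹ := inv_pos.2 (by linarith)
  apply add_le_add (le_mul_of_one_le_right (norm_nonneg _) h3)
  calc _ ≤ ((r - q)⁻¹ * Real.exp ((r - q) * ‖t‖)) * (W * (C * Real.exp (q * ‖t‖))) := by gcongr
    _ = (r - q)⁻¹ * (W * C) * (Real.exp ((r - q) * ‖t‖) * Real.exp (q * ‖t‖)) := by ring
    _ = _ := by rw [← Real.exp_add]; congr 2; ring

theorem integrableOn_exp_mul_cpow_mul {ζ β : ℂ} (hβ : -1 < β.re) {G : ℝ → ℂ} {C q : ℝ}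
    (hG : ContinuousOn G (Ioi 0)) (hb : ∀ t : ℝ, 0 < t → ‖G t‖ ≤ C * Real.exp (q * t))
    (hq : q < ζ.re) :
    IntegrableOn (fun t : ℝ => Complex.exp (-ζ * t) * ((t : ℂ) ^ β * G t)) (Ioi 0) := by
  have h := (integrableOn_rpow_mul_exp_neg_mul_rpow hβ one_pos (sub_pos.2 hq)).const_mul C
  refine h.mono' ?_ ?_
  · refine ContinuousOn.aestronglyMeasurable ?_ measurableSet_Ioi
    refine ContinuousOn.mul (by fun_prop) (ContinuousOn.mul ?_ hG)
    intro t ht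
    exact (Complex.continuousAt_ofReal_cpow_const t β (Or.inr (ne_of_gt ht))).continuousWithinAt
  · refine (ae_restrict_iff' measurableSet_Ioi).2 (Eventually.of_forall fun t ht => ?_)
    have ht : 0 < t := ht
    rw [norm_mul, norm_mul, Complex.norm_cpow_eq_rpow_re_of_pos ht, Complex.norm_exp,
      Real.rpow_one]
    have hre : (-ζ * t).re = -(ζ.re * t) := by simp
    rw [hre]
    calc _ ≤ Real.exp (-(ζ.re * t)) * (t ^ β.re * (C * Real.exp (q * t))) := by
          have := hb t ht
          gcongr
      _ = C * (t ^ β.re * (Real.exp (-(ζ.re * t)) * Real.exp (q * t))) := by ring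
      _ = _ := by rw [← Real.exp_add]; congr 3; ring

theorem eqOn_of_forall_ofReal_eq {U : Set ℂ} {f g : ℂ → ℂ} (hf : AnalyticOnNhd ℂ f U)
    (hg : AnalyticOnNhd ℂ g U) (hU : IsPreconnected U) (h1 : 1 ∈ U)
    (h : ∀ t : ℝ, 0 < t → f t = g t) : EqOn f g U := by
  refine hf.eqOn_of_preconnected_of_frequently_eq hg hU h1 ?_
  have ht : Tendsto (fun t : ℝ => (t : ℂ)) (𝓝[≠] 1) (𝓝[≠] 1) := by
    refine tendsto_nhdsWithin_iff.2 ⟨?_, ?_⟩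
    · exact (Complex.continuous_ofReal.tendsto' 1 1 (by simp)).mono_left nhdsWithin_le_nhds
    · filter_upwards [self_mem_nhdsWithin] with t ht
      simpa using ht
  refine ht.frequently (Eventually.frequently ?_)
  filter_upwards [nhdsWithin_le_nhds (Ioi_mem_nhds (zero_lt_one (α := ℝ)))] with t ht using h t ht

/-- The Laplace transform of a power, by analytic continuation from the positive `ζ`. -/
theorem integral_exp_mul_cpow {β : ℂ} (hβ : -1 < β.re) {ζ : ℂ} (hζ : 0 < ζ.re) :
    ∫ t in Ioi (0 : ℝ), Complex.exp (-ζ * t) * (t : ℂ) ^ β =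
      Complex.Gamma (β + 1) * ζ ^ (-(β + 1)) := by
  set U : Set ℂ := {z | 0 < z.re}
  have hUo : IsOpen U := isOpen_lt continuous_const Complex.continuous_re
  have hUc : IsPreconnected U := (convex_halfSpace_re_gt 0).isPreconnected
  have hint : ∀ γ : ℂ, -1 < γ.re → ∀ z : ℂ, 0 < z.re →
      IntegrableOn (fun t : ℝ => Complex.exp (-z * t) * (t : ℂ) ^ γ) (Ioi 0) := by
    intro γ hγ z hz
    have := integrableOn_exp_mul_cpow_mul hγ (G := fun _ => 1) (C := 1) (q := 0)
      continuousOn_const (fun t _ => by simp) hz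
    simpa using this
  have hd : DifferentiableOn ℂ
      (fun z : ℂ => ∫ t in Ioi (0 : ℝ), Complex.exp (-z * t) * (t : ℂ) ^ β) U := by
    intro z hz
    have hz : 0 < z.re := hz
    have hnh : {x : ℂ | z.re / 2 < x.re} ∈ 𝓝 z :=
      (isOpen_lt continuous_const Complex.continuous_re).mem_nhds (by
        change z.re / 2 < z.re; linarith)
    have hb1 := hint (β + 1) (by simp; linarith) ((z.re / 2 : ℝ) : ℂ) (by
      rw [Complex.ofReal_re]; linarith)
    have hmeas : ∀ x : ℂ, AEStronglyMeasurable
        (fun t : ℝ => Complex.exp (-x * t) * (-t) * (t : ℂ) ^ β) (volume.restrict (Ioi 0)) := by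
      intro x
      refine ContinuousOn.aestronglyMeasurable ?_ measurableSet_Ioi
      refine ContinuousOn.mul (by fun_prop) ?_
      intro t ht
      exact (Complex.continuousAt_ofReal_cpow_const t β (Or.inr (ne_of_gt ht))).continuousWithinAt
    refine (hasDerivAt_integral_of_dominated_loc_of_deriv_le
      (F := fun (z : ℂ) (t : ℝ) => Complex.exp (-z * t) * (t : ℂ) ^ β)
      (F' := fun (z : ℂ) (t : ℝ) => Complex.exp (-z * t) * (-t) * (t : ℂ) ^ β)
      (bound := fun t : ℝ => ‖Complex.exp (-((z.re / 2 : ℝ) : ℂ) * t) * (t : ℂ) ^ (β + 1)‖)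
      hnh ?_ (hint β hβ z hz) (hmeas z) ?_ hb1.norm
      ?_).2.differentiableAt.differentiableWithinAt
    · filter_upwards [hUo.mem_nhds hz] with x hx
      exact (hint β hβ x hx).aestronglyMeasurable
    · refine (ae_restrict_iff' measurableSet_Ioi).2 (Eventually.of_forall fun t ht x hx => ?_)
      have ht : 0 < t := ht
      have hx : z.re / 2 < x.re := hx
      have h0 : (t : ℂ) ^ (β + 1) = t * (t : ℂ) ^ β := by
        rw [Complex.cpow_add _ _ (by exact_mod_cast ht.ne'), Complex.cpow_one, mul_comm]
      rw [h0, mul_assoc, norm_mul, norm_mul (Complex.exp _), norm_mul (-(t : ℂ)), norm_neg,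
        ← norm_mul (t : ℂ), Complex.norm_exp, Complex.norm_exp]
      have h1 : ∀ y : ℂ, (-y * t).re = -(y.re * t) := fun y => by simp
      rw [h1, h1, Complex.ofReal_re]
      gcongr
    · refine Eventually.of_forall fun t x _ => ?_
      have := (((hasDerivAt_id x).neg.mul_const (t : ℂ)).cexp).mul_const ((t : ℂ) ^ β)
      simpa using this
  have hd2 : DifferentiableOn ℂ (fun z : ℂ => Complex.Gamma (β + 1) * z ^ (-(β + 1))) U := by
    intro z hz
    have : z ∈ Complex.slitPlane := Or.inl hz
    exact (((hasDerivAt_id z).cpow_const this).differentiableAt.const_mul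
      _).differentiableWithinAt
  refine eqOn_of_forall_ofReal_eq (hd.analyticOnNhd hUo) (hd2.analyticOnNhd hUo) hUc
    (show (0 : ℝ) < (1 : ℂ).re by simp) (fun r hr => ?_) hζ
  have h := Complex.integral_cpow_mul_exp_neg_mul_Ioi (a := β + 1) (by simp; linarith) hr
  simp only [add_sub_cancel_right] at h
  have h2 : ∀ t : ℝ, Complex.exp (-(r : ℂ) * t) * (t : ℂ) ^ β =
      (t : ℂ) ^ β * Complex.exp (-(r * t)) := fun t => by rw [mul_comm, neg_mul]
  simp_rw [h2]
  rw [h, mul_comm, one_div, Complex.inv_cpow, ← Complex.cpow_neg]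
  rw [Complex.arg_ofReal_of_nonneg hr.le]
  exact Real.pi_pos.ne

/-- On the positive half-line `t^α 𝓘_α F` is a convolution with `t^α`, up to the boundary term. -/
theorem cpow_mul_fracInt (α : ℂ) (F : ℂ → ℂ) {x : ℝ} (hx : 0 < x) :
    (x : ℂ) ^ α * fracInt α F x = ((x : ℂ) ^ α * F 0 +
      ∫ s in (0 : ℝ)..x, (s : ℂ) ^ α * deriv F ((x - s : ℝ) : ℂ)) / Complex.Gamma (α + 1) := by
  have hx0 : (x : ℂ) ≠ 0 := by exact_mod_cast hx.ne'
  have h1 := intervalIntegral.integral_comp_mul_left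
    (fun s : ℝ => (s : ℂ) ^ α * deriv F ((x - s : ℝ) : ℂ)) (a := 0) (b := 1) hx.ne'
  rw [mul_zero, mul_one] at h1
  have h2 : ∫ s in (0 : ℝ)..x, (s : ℂ) ^ α * deriv F ((x - s : ℝ) : ℂ) =
      x * ∫ v in (0 : ℝ)..1, ((x * v : ℝ) : ℂ) ^ α * deriv F ((x - x * v : ℝ) : ℂ) := by
    rw [h1, Complex.real_smul, ← mul_assoc, Complex.ofReal_inv, mul_inv_cancel₀ hx0, one_mul]
  have h3 := intervalIntegral.integral_comp_sub_left
    (fun v : ℝ => ((x * v : ℝ) : ℂ) ^ α * deriv F ((x - x * v : ℝ) : ℂ)) (a := 0) (b := 1) 1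
  rw [sub_self, sub_zero] at h3
  rw [fracInt, h2, ← h3, mul_div_assoc', mul_add, mul_left_comm,
    ← intervalIntegral.integral_const_mul]
  congr 3
  refine intervalIntegral.integral_congr fun u hu => ?_
  rw [uIcc_of_le zero_le_one] at hu
  rw [Complex.ofReal_mul, Complex.mul_cpow_ofReal_nonneg hx.le (by linarith [hu.2]), mul_assoc]
  congr 4
  push_cast
  ring

theorem MemH.continuousOn_ofReal (hF : MemH a R F) (ha : 0 < a) :
    ContinuousOn (fun t : ℝ => F t) (Ici 0) :=
  hF.analytic.continuousOn.comp Complex.continuous_ofReal.continuousOn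
    fun _ ht => ofReal_mem_regionD ha ht

theorem MemH.integrableOn (hF : MemH a R F) (ha : 0 < a) (hR : 0 ≤ R) {ζ : ℂ} (hζ : R < ζ.re)
    {β : ℂ} (hβ : -1 < β.re) :
    IntegrableOn (laplaceIntegrand (fun t => t ^ β * F t) ζ) (Ioi 0) := by
  obtain ⟨C, _, hC⟩ := hF.exists_bound hR (r := (R + ζ.re) / 2) (A := a / 2) (by linarith)
    (by linarith) (by linarith)
  refine integrableOn_exp_mul_cpow_mul hβ (G := fun t => F t) (C := C) (q := (R + ζ.re) / 2)
    ((hF.continuousOn_ofReal ha).mono Ioi_subset_Ici_self) (fun t ht => ?_) (by linarith)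
  have := hC t (ofReal_mem_regionD (by linarith) ht.le)
  rwa [Complex.norm_real, Real.norm_of_nonneg ht.le] at this

theorem MemH.integrableOn_laplaceIntegrand (hF : MemH a R F) (ha : 0 < a) (hR : 0 ≤ R) {ζ : ℂ}
    (hζ : R < ζ.re) : IntegrableOn (laplaceIntegrand F ζ) (Ioi 0) := by
  simpa using hF.integrableOn ha hR hζ (β := 0) (by simp)

theorem MemH.integrableOn_deriv (hF : MemH a R F) (ha : 0 < a) (hR : 0 ≤ R) {ζ : ℂ}
    (hζ : R < ζ.re) : IntegrableOn (laplaceIntegrand (deriv F) ζ) (Ioi 0) := by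
  obtain ⟨C, _, hC⟩ := hF.exists_bound_deriv hR (r := (R + ζ.re) / 2) (A := a / 2) (by linarith)
    (by linarith) (by linarith)
  have := integrableOn_exp_mul_cpow_mul (ζ := ζ) (β := 0) (by simp) (G := fun t => deriv F t)
    (C := C) (q := (R + ζ.re) / 2)
    (((hF.differentiableOn.deriv (isOpen_regionD a)).continuousOn.comp
      Complex.continuous_ofReal.continuousOn
      fun _ ht => ofReal_mem_regionD ha ht).mono Ioi_subset_Ici_self) (fun t ht => ?_) (by linarith)
  · refine this.congr_fun (fun t _ => ?_) measurableSet_Ioi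
    simp only [Complex.cpow_zero, one_mul, laplaceIntegrand]
  · have := hC t (ofReal_mem_regionD (by linarith) ht.le)
    rwa [Complex.norm_real, Real.norm_of_nonneg ht.le] at this

theorem MemH.laplace_eq (hF : MemH a R F) (ha : 0 < a) (hR : 0 ≤ R) {ζ : ℂ} (hζ : R < ζ.re) :
    laplace F ζ = F 0 + ∫ t in Ioi (0 : ℝ), laplaceIntegrand (deriv F) ζ t := by
  obtain ⟨C, _, hC⟩ := hF.exists_bound hR (r := (R + ζ.re) / 2) (A := a / 2) (by linarith)
    (by linarith) (by linarith)
  have hlim : Tendsto (fun t : ℝ => Complex.exp (-ζ * t) * F t) atTop (𝓝 0) := by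
    have h0 : Tendsto (fun t : ℝ => C * Real.exp (-((ζ.re - R) / 2 * t))) atTop (𝓝 0) := by
      have h1 : Tendsto (fun t : ℝ => (ζ.re - R) / 2 * t) atTop atTop :=
        tendsto_id.const_mul_atTop (by linarith)
      simpa using (Real.tendsto_exp_neg_atTop_nhds_zero.comp h1).const_mul C
    refine squeeze_zero_norm' ?_ h0
    filter_upwards [eventually_gt_atTop 0] with t ht
    have := hC t (ofReal_mem_regionD (by linarith) ht.le)
    rw [Complex.norm_real, Real.norm_of_nonneg ht.le] at this
    rw [norm_mul, Complex.norm_exp]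
    have hre : (-ζ * t).re = -(ζ.re * t) := by simp
    rw [hre]
    calc _ ≤ Real.exp (-(ζ.re * t)) * (C * Real.exp ((R + ζ.re) / 2 * t)) := by gcongr
      _ = C * (Real.exp (-(ζ.re * t)) * Real.exp ((R + ζ.re) / 2 * t)) := by ring
      _ = _ := by rw [← Real.exp_add]; congr 2; ring
  have hI1 := (hF.integrableOn_laplaceIntegrand ha hR hζ).const_mul (-ζ)
  have hI2 := hF.integrableOn_deriv ha hR hζ
  have h := integral_Ioi_of_hasDerivAt_of_tendsto' (a := (0 : ℝ))
    (f := fun t : ℝ => Complex.exp (-ζ * t) * F t)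
    (f' := fun t : ℝ => -ζ * laplaceIntegrand F ζ t + laplaceIntegrand (deriv F) ζ t)
    (m := 0) (fun t ht => by
      have h1 : HasDerivAt F (deriv F t) (t : ℂ) := (hF.differentiableOn.differentiableAt
        ((isOpen_regionD a).mem_nhds (ofReal_mem_regionD ha ht))).hasDerivAt
      have h2 : HasDerivAt (fun t : ℝ => (t : ℂ)) 1 t := Complex.ofRealCLM.hasDerivAt
      have h3 := ((h2.const_mul (-ζ)).cexp).mul (h1.comp t h2)
      refine h3.congr_deriv ?_
      simp only [laplaceIntegrand, Function.comp_apply]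
      ring) (hI1.add hI2) hlim
  rw [integral_add hI1 hI2, integral_const_mul] at h
  simp only [Complex.ofReal_zero, mul_zero, Complex.exp_zero, one_mul, zero_sub] at h
  rw [laplace]
  linear_combination -h

theorem isFracIntegral_fracInt (ha : 0 < a) (hR : 0 ≤ R) (hα : -1 < α.re) (hF : MemH a R F) :
    IsFracIntegral R α F (fracInt α F) := by
  intro ζ hζ
  have hζ0 : 0 < ζ.re := by linarith
  have hζne : ζ ≠ 0 := by rintro rfl; simp at hζ0
  refine ⟨hF.integrableOn_laplaceIntegrand ha hR hζ,
    (memH_fracInt hR hα hF).integrableOn ha hR hζ hα, ?_⟩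
  have hI1 : IntegrableOn (fun t : ℝ => Complex.exp (-ζ * t) * (t : ℂ) ^ α) (Ioi 0) := by
    have := integrableOn_exp_mul_cpow_mul (ζ := ζ) hα (G := fun _ => 1) (C := 1) (q := 0)
      continuousOn_const (fun t _ => by simp) hζ0
    simpa using this
  have hI2 := hF.integrableOn_deriv ha hR hζ
  have hconv := integral_posConvolution hI1 hI2 (ContinuousLinearMap.mul ℝ ℂ)
  have hconvI := integrable_posConvolution hI1 hI2 (ContinuousLinearMap.mul ℝ ℂ)
  rw [posConvolution, integrable_indicator_iff measurableSet_Ioi] at hconvI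
  simp_rw [ContinuousLinearMap.mul_apply'] at hconv hconvI
  have hpt : ∀ x ∈ Ioi (0 : ℝ), laplaceIntegrand (fun t => t ^ α * fracInt α F t) ζ x =
      (Complex.exp (-ζ * x) * (x : ℂ) ^ α * F 0 + ∫ s in (0 : ℝ)..x,
        Complex.exp (-ζ * s) * (s : ℂ) ^ α * laplaceIntegrand (deriv F) ζ (x - s)) /
          Complex.Gamma (α + 1) := by
    intro x hx
    rw [laplaceIntegrand, cpow_mul_fracInt α F hx, mul_div_assoc', mul_add, mul_assoc,
      ← intervalIntegral.integral_const_mul]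
    congr 3
    ext s
    rw [laplaceIntegrand]
    have : Complex.exp (-ζ * x) = Complex.exp (-ζ * s) * Complex.exp (-ζ * (x - s : ℝ)) := by
      rw [← Complex.exp_add]; congr 1; push_cast; ring
    rw [this]
    ring
  rw [laplaceAlpha, laplace, setIntegral_congr_fun measurableSet_Ioi hpt, integral_div,
    integral_add (hI1.mul_const _) hconvI, integral_mul_const, hconv,
    integral_exp_mul_cpow hα hζ0, hF.laplace_eq ha hR hζ]
  have hG := Gamma_add_one_ne_zero hα
  have hp : ζ ^ α * ζ * ζ ^ (-(α + 1)) = 1 := by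
    rw [Complex.cpow_neg, Complex.cpow_add _ _ hζne, Complex.cpow_one]
    exact mul_inv_cancel₀ (mul_ne_zero (by simp [Complex.cpow_eq_zero_iff, hζne]) hζne)
  field_simp
  linear_combination (F 0 + ∫ t in Ioi (0 : ℝ), laplaceIntegrand (deriv F) ζ t) * hp

end Transform

/-! ### Uniqueness of the fractional integral -/

/-- Injectivity of the Laplace transform on a vertical line: for a continuous `f` the integrals
along `Re ζ = σ` are the values of a Fourier transform, which can be inverted. -/
theorem eq_zero_of_forall_integral_exp_eq_zero {f : ℝ → ℂ} (hf : ContinuousOn f (Ioi 0)) {σ : ℝ}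
    (hint : IntegrableOn (fun t : ℝ => Complex.exp (-(σ : ℂ) * t) * f t) (Ioi 0))
    (h0 : ∀ ζ : ℂ, ζ.re = σ → ∫ t in Ioi (0 : ℝ), Complex.exp (-ζ * t) * f t = 0) {v : ℝ}
    (hv : 0 < v) : f v = 0 := by
  set g : ℝ → ℂ := indicator (Ioi 0) fun t : ℝ => Complex.exp (-(σ : ℂ) * t) * f t with hg
  have hgi : Integrable g := (integrable_indicator_iff measurableSet_Ioi).2 hint
  have hfour : FourierTransform.fourier g = 0 := by
    ext w
    rw [Real.fourier_real_eq_integral_exp_smul]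
    have := h0 (σ + (2 * Real.pi * w : ℝ) * Complex.I) (by simp)
    rw [Pi.zero_apply, ← this, ← integral_indicator measurableSet_Ioi]
    congr 1 with t
    by_cases ht : t ∈ Ioi (0 : ℝ)
    · rw [hg, indicator_of_mem ht, indicator_of_mem ht, smul_eq_mul, ← mul_assoc,
        ← Complex.exp_add]
      congr 2
      push_cast
      ring
    · rw [hg, indicator_of_notMem ht, indicator_of_notMem ht, smul_zero]
  have hgc : ContinuousAt g v := by
    have h1 : ContinuousAt (fun t : ℝ => Complex.exp (-(σ : ℂ) * t) * f t) v :=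
      ContinuousAt.mul (by fun_prop) (hf.continuousAt (Ioi_mem_nhds hv))
    refine h1.congr ?_
    filter_upwards [Ioi_mem_nhds hv] with t ht
    rw [hg, indicator_of_mem ht]
  have hinv := hgi.fourierInv_fourier_eq (by rw [hfour]; exact integrable_zero _ _ _) hgc
  rw [hfour, Real.fourierInv_eq] at hinv
  simp only [Pi.zero_apply, smul_zero, integral_zero] at hinv
  rw [hg, indicator_of_mem (show v ∈ Ioi 0 from hv)] at hinv
  exact (mul_eq_zero.1 hinv.symm).resolve_left (Complex.exp_ne_zero _)

theorem IsFracIntegral.eq_ofReal {R R' : ℝ} (hR : 0 ≤ R) {α : ℂ} {F G₁ G₂ : ℂ → ℂ}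
    (h₁ : IsFracIntegral R α F G₁) (h₂ : IsFracIntegral R' α F G₂)
    (hc₁ : ContinuousOn (fun t : ℝ => G₁ t) (Ioi 0))
    (hc₂ : ContinuousOn (fun t : ℝ => G₂ t) (Ioi 0)) {t : ℝ} (ht : 0 < t) : G₁ t = G₂ t := by
  set σ : ℝ := max R R' + 1
  have hσR : R < σ := by have := le_max_left R R'; linarith
  have hσR' : R' < σ := by have := le_max_right R R'; linarith
  have hpow : ContinuousOn (fun t : ℝ => (t : ℂ) ^ α) (Ioi 0) := fun t ht =>
    (Complex.continuousAt_ofReal_cpow_const t α (Or.inr (ne_of_gt ht))).continuousWithinAt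
  have hsub : ∀ (ζ : ℂ) (t : ℝ), Complex.exp (-ζ * t) * ((t : ℂ) ^ α * (G₁ t - G₂ t)) =
      laplaceIntegrand (fun t => t ^ α * G₁ t) ζ t -
        laplaceIntegrand (fun t => t ^ α * G₂ t) ζ t := fun ζ t => by
    simp only [laplaceIntegrand]; ring
  have key : (t : ℂ) ^ α * (G₁ t - G₂ t) = 0 := by
    refine eq_zero_of_forall_integral_exp_eq_zero (σ := σ)
      (f := fun t : ℝ => (t : ℂ) ^ α * (G₁ t - G₂ t)) (hpow.mul (hc₁.sub hc₂)) ?_ ?_ ht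
    · simp_rw [hsub]
      exact (h₁ σ (by simpa)).2.1.sub (h₂ σ (by simpa)).2.1
    · intro ζ hζ
      have H₁ := h₁ ζ (by rwa [hζ])
      have H₂ := h₂ ζ (by rwa [hζ])
      have hζ0 : ζ ≠ 0 := by
        rintro rfl
        rw [Complex.zero_re] at hζ
        linarith
      simp_rw [hsub]
      rw [integral_sub H₁.2.1 H₂.2.1]
      have h := H₁.2.2.trans H₂.2.2.symm
      rw [laplaceAlpha, laplaceAlpha, laplace, laplace] at h
      have hp : ζ ^ α ≠ 0 := by simp [Complex.cpow_eq_zero_iff, hζ0]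
      exact sub_eq_zero.2 (mul_left_cancel₀ hζ0 (mul_left_cancel₀ hp h))
  have hp : (t : ℂ) ^ α ≠ 0 := by simp [Complex.cpow_eq_zero_iff, ht.ne']
  exact sub_eq_zero.1 ((mul_eq_zero.1 key).resolve_left hp)

theorem IsFracIntegral.eqOn {a a' R R' : ℝ} (ha : 0 < a) (ha' : 0 < a') (hR : 0 ≤ R) {α : ℂ}
    {F G₁ G₂ : ℂ → ℂ} (h₁ : IsFracIntegral R α F G₁) (h₂ : IsFracIntegral R' α F G₂)
    (hG₁ : MemH a R G₁) (hG₂ : MemH a' R' G₂) : EqOn G₁ G₂ (regionD (min a a')) := by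
  have hm : 0 < min a a' := lt_min ha ha'
  refine eqOn_of_forall_ofReal_eq (hG₁.analytic.mono (regionD_mono (min_le_left _ _)))
    (hG₂.analytic.mono (regionD_mono (min_le_right _ _))) (isPreconnected_regionD hm)
    (by simpa using ofReal_mem_regionD hm zero_le_one) fun t ht => ?_
  exact h₁.eq_ofReal hR h₂ ((hG₁.continuousOn_ofReal ha).mono Ioi_subset_Ici_self)
    ((hG₂.continuousOn_ofReal ha').mono Ioi_subset_Ici_self) ht

/-! ### The hypergeometric kernel -/

/-- The function `u ↦ u^k / (1 - uz)` has the derivative `k u^(k-1) / (1 - uz) + z u^k / (1 - uz)²`.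
This is `Γ(α + 1)` times the fractional integral of `t ↦ t^k / (1 - tz)` at `t = 1`: the value at `0`, which is `1` for `k = 0` and `0` otherwise, plus the integral of the
derivative against `(1 - u)^α`. -/
noncomputable def hypKernel (α : ℂ) (k : ℕ) (z : ℂ) : ℂ :=
  0 ^ k + ∫ u in (0 : ℝ)..1, ((1 - u : ℝ) : ℂ) ^ α *
    (k * (u : ℂ) ^ (k - 1) * (1 - u * z)⁻¹ + z * (u : ℂ) ^ k * (1 - u * z)⁻¹ ^ 2)

theorem isOpen_cutPlane : IsOpen cutPlane :=
  Complex.isOpen_slitPlane.preimage (by fun_prop)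

theorem starZero_cutPlane : StarZero cutPlane := by
  intro z hz u hu
  have h := starConvex_iff_segment_subset.1 Complex.starConvex_one_slitPlane hz
  have hm : 1 - (u : ℂ) * z ∈ segment ℝ 1 (1 - z) := by
    refine ⟨1 - u, u, by linarith [hu.2], hu.1, by ring, ?_⟩
    simp only [Complex.real_smul]
    push_cast
    ring
  exact h hm

theorem one_sub_ne_zero_of_mem_cutPlane {z : ℂ} (hz : z ∈ cutPlane) : 1 - z ≠ 0 :=
  Complex.slitPlane_ne_zero hz

theorem differentiableOn_hypKernel {α : ℂ} (hα : -1 < α.re) (k : ℕ) :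
    DifferentiableOn ℂ (hypKernel α k) cutPlane := by
  have hg : DifferentiableOn ℂ (fun z : ℂ => (1 - z)⁻¹) cutPlane := fun z hz =>
    (DifferentiableAt.inv (by fun_prop)
      (one_sub_ne_zero_of_mem_cutPlane hz)).differentiableWithinAt
  have hg2 : DifferentiableOn ℂ (fun z : ℂ => (1 - z)⁻¹ ^ 2) cutPlane := hg.pow 2
  have hw := intervalIntegrable_one_sub_cpow hα
  have hw1 : IntervalIntegrable
      (fun u : ℝ => ((1 - u : ℝ) : ℂ) ^ α * (k * (u : ℂ) ^ (k - 1))) volume 0 1 :=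
    hw.mul_continuousOn (by fun_prop)
  have hw2 : IntervalIntegrable
      (fun u : ℝ => ((1 - u : ℝ) : ℂ) ^ α * (u : ℂ) ^ k) volume 0 1 :=
    hw.mul_continuousOn (by fun_prop)
  have hd : DifferentiableOn ℂ (fun z : ℂ => 0 ^ k +
      ((∫ u in (0 : ℝ)..1, ((1 - u : ℝ) : ℂ) ^ α * (k * (u : ℂ) ^ (k - 1)) * (1 - u * z)⁻¹) +
        z * ∫ u in (0 : ℝ)..1, ((1 - u : ℝ) : ℂ) ^ α * (u : ℂ) ^ k * (1 - u * z)⁻¹ ^ 2))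
      cutPlane := by
    intro z hz
    have h1 := (starZero_cutPlane.hasDerivAt_integral isOpen_cutPlane hg hw1 hz).differentiableAt
    have h2 := (starZero_cutPlane.hasDerivAt_integral isOpen_cutPlane hg2 hw2 hz).differentiableAt
    exact ((h1.add (differentiableAt_id.mul h2)).const_add _).differentiableWithinAt
  refine hd.congr fun z hz => ?_
  rw [hypKernel, ← intervalIntegral.integral_const_mul, ← intervalIntegral.integral_add
    (starZero_cutPlane.intervalIntegrable_mul_comp hg.continuousOn hw1 hz)
    ((starZero_cutPlane.intervalIntegrable_mul_comp hg2.continuousOn hw2 hz).const_mul z)]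
  congr 2
  ext u
  ring

theorem integral_one_sub_cpow_mul_pow {α : ℂ} (hα : -1 < α.re) (n : ℕ) :
    0 ^ n + ∫ u in (0 : ℝ)..1, ((1 - u : ℝ) : ℂ) ^ α * (n * (u : ℂ) ^ (n - 1)) =
      n.factorial * Complex.Gamma (α + 1) / Complex.Gamma (α + n + 1) := by
  have hG := Gamma_add_ne_zero hα n
  rcases n with _ | n
  · have := Gamma_add_one_ne_zero hα
    simp [this]
  · have hs : (0 : ℝ) < ((n : ℂ) + 1).re := by simp; positivity
    have ht : (0 : ℝ) < (α + 1).re := by simp; linarith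
    have h := Complex.Gamma_mul_Gamma_eq_betaIntegral hs ht
    have hB : ∫ u in (0 : ℝ)..1, ((1 - u : ℝ) : ℂ) ^ α * (((n + 1 : ℕ) : ℂ) * (u : ℂ) ^ n) =
        (n + 1 : ℕ) * Complex.betaIntegral (n + 1) (α + 1) := by
      rw [Complex.betaIntegral, ← intervalIntegral.integral_const_mul]
      congr 1 with u
      rw [add_sub_cancel_right, add_sub_cancel_right, Complex.cpow_natCast]
      push_cast
      ring
    rw [Nat.add_sub_cancel, hB, zero_pow (Nat.succ_ne_zero n), zero_add, eq_div_iff hG]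
    rw [Complex.Gamma_nat_eq_factorial] at h
    have e : α + ((n + 1 : ℕ) : ℂ) + 1 = n + 1 + (α + 1) := by push_cast; ring
    rw [e, Nat.factorial_succ]
    push_cast
    linear_combination (-(n + 1 : ℂ)) * h

theorem hasSum_hypKernel {α : ℂ} (hα : -1 < α.re) (k : ℕ) {z : ℂ} (hz : ‖z‖ < 1) :
    HasSum (fun m : ℕ => ((k + m).factorial * Complex.Gamma (α + 1) /
      Complex.Gamma (α + (k + m : ℕ) + 1)) * z ^ m) (hypKernel α k z) := by
  have hw := intervalIntegrable_one_sub_cpow hα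
  have hsumb : Summable fun m : ℕ => (k + m : ℝ) * ‖z‖ ^ m := by
    simp_rw [add_mul]
    refine ((summable_geometric_of_lt_one (norm_nonneg z) hz).mul_left _).add ?_
    simpa using summable_pow_mul_geometric_of_norm_lt_one 1
      (r := ‖z‖) (by rwa [norm_norm])
  have h1 : HasSum (fun m : ℕ => ∫ u in (0 : ℝ)..1,
      ((1 - u : ℝ) : ℂ) ^ α * (((k + m : ℕ) : ℂ) * (u : ℂ) ^ (k + m - 1)) * z ^ m)
      (∫ u in (0 : ℝ)..1, ((1 - u : ℝ) : ℂ) ^ α *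
        (k * (u : ℂ) ^ (k - 1) * (1 - u * z)⁻¹ + z * (u : ℂ) ^ k * (1 - u * z)⁻¹ ^ 2)) := by
    refine intervalIntegral.hasSum_integral_of_dominated_convergence
      (fun m u => ‖((1 - u : ℝ) : ℂ) ^ α‖ * ((k + m : ℝ) * ‖z‖ ^ m)) ?_ ?_ ?_ ?_ ?_
    · intro m
      exact ((hw.mul_continuousOn (by fun_prop)).mul_const _).def'.aestronglyMeasurable
    · refine fun m => Eventually.of_forall fun u hu => ?_
      rw [uIoc_of_le zero_le_one] at hu
      have hu1 : ‖(u : ℂ)‖ ≤ 1 := by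
        rw [Complex.norm_real, Real.norm_of_nonneg hu.1.le]; exact hu.2
      rw [mul_assoc, norm_mul, norm_mul, norm_mul, norm_pow, norm_pow, Complex.norm_natCast]
      push_cast
      gcongr
      exact mul_le_of_le_one_right (by positivity) (pow_le_one₀ (norm_nonneg _) hu1)
    · exact Eventually.of_forall fun u _ => hsumb.mul_left _
    · simp_rw [tsum_mul_left]
      exact hw.norm.mul_const _
    · refine Eventually.of_forall fun u hu => ?_
      rw [uIoc_of_le zero_le_one] at hu
      have hu0 : (u : ℂ) ≠ 0 := by exact_mod_cast hu.1.ne'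
      have huz : ‖(u : ℂ) * z‖ < 1 := by
        rw [norm_mul, Complex.norm_real, Real.norm_of_nonneg hu.1.le]
        exact (mul_le_of_le_one_left (norm_nonneg _) hu.2).trans_lt hz
      have hne : 1 - (u : ℂ) * z ≠ 0 := by
        intro h
        rw [← sub_eq_zero.1 h] at huz
        simp at huz
      have hs := (((hasSum_geometric_of_norm_lt_one huz).mul_left (k : ℂ)).add
        (hasSum_coe_mul_geometric_of_norm_lt_one huz)).mul_left
          (((1 - u : ℝ) : ℂ) ^ α * ((u : ℂ) ^ k * (u : ℂ)⁻¹))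
      have hpow : ∀ n : ℕ, (n : ℂ) * (u : ℂ) ^ (n - 1) = n * ((u : ℂ) ^ n * (u : ℂ)⁻¹) := by
        intro n
        rcases n with _ | n
        · simp
        · rw [Nat.add_sub_cancel, pow_succ, mul_assoc, mul_inv_cancel₀ hu0, mul_one]
      have hval : ((1 - u : ℝ) : ℂ) ^ α *
          (k * (u : ℂ) ^ (k - 1) * (1 - u * z)⁻¹ + z * (u : ℂ) ^ k * (1 - u * z)⁻¹ ^ 2) =
          ((1 - u : ℝ) : ℂ) ^ α * ((u : ℂ) ^ k * (u : ℂ)⁻¹) *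
            (k * (1 - u * z)⁻¹ + u * z / (1 - u * z) ^ 2) := by
        rw [hpow]
        field_simp
      rw [hval]
      refine hs.congr_fun fun m => ?_
      rw [hpow, mul_pow, pow_add]
      push_cast
      ring
  have h2 : HasSum (fun m : ℕ => (0 : ℂ) ^ (k + m) * z ^ m) (0 ^ k) := by
    have := hasSum_single (f := fun m : ℕ => (0 : ℂ) ^ (k + m) * z ^ m) 0 (fun m hm => by
      simp [hm])
    simpa using this
  rw [hypKernel]
  refine (h2.add h1).congr_fun fun m => ?_
  rw [intervalIntegral.integral_mul_const, ← add_mul, integral_one_sub_cpow_mul_pow hα]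

/-- The principal branch of `₂F₁(k + 1, 1; α + k + 1; z)` is a multiple of `hypKernel α k z`. -/
theorem hyp2F1_eq {α : ℂ} (hα : -1 < α.re) (k : ℕ) {z : ℂ} (hz : z ∈ cutPlane) :
    hyp2F1 (k + 1) 1 (α + k + 1) z =
      Complex.Gamma (α + k + 1) / (k.factorial * Complex.Gamma (α + 1)) * hypKernel α k z := by
  set g : ℂ → ℂ := fun z =>
    Complex.Gamma (α + k + 1) / (k.factorial * Complex.Gamma (α + 1)) * hypKernel α k z with hgdef
  have hc : ∀ m : ℕ, α + k + 1 ≠ -(m : ℂ) := by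
    intro m h
    have := congrArg Complex.re h
    have h1 : (0 : ℝ) ≤ k := Nat.cast_nonneg k
    have h2 : (0 : ℝ) ≤ m := Nat.cast_nonneg m
    simp at this
    linarith
  have hg : IsHypergeometricBranch (k + 1) 1 (α + k + 1) g := by
    refine ⟨((differentiableOn_hypKernel hα k).const_mul _).analyticOnNhd isOpen_cutPlane, ?_⟩
    intro z hz
    have hs := (hasSum_hypKernel hα k (by simpa using hz)).mul_left
      (Complex.Gamma (α + k + 1) / (k.factorial * Complex.Gamma (α + 1)))
    simp only [hgdef]
    rw [ordinaryHypergeometric_eq_tsum, ← hs.tsum_eq]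
    refine tsum_congr fun m => ?_
    have hG1 := Gamma_add_one_ne_zero hα
    have hGk := Gamma_add_ne_zero hα k
    have hGm := Gamma_add_ne_zero hα (k + m)
    have e1 : (ascPochhammer ℂ m).eval ((k : ℂ) + 1) = (k + m).factorial / k.factorial := by
      have h := Nat.factorial_mul_ascFactorial k m
      rw [← Nat.cast_succ, ascPochhammer_nat_eq_natCast_ascFactorial, ← h, Nat.cast_mul,
        mul_div_cancel_left₀ _ (by exact_mod_cast k.factorial_ne_zero)]
    have e2 : (ascPochhammer ℂ m).eval (1 : ℂ) = m.factorial := by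
      have h := ascPochhammer_nat_eq_natCast_ascFactorial ℂ 1 m
      rw [Nat.cast_one] at h
      rw [h, Nat.one_ascFactorial]
    have e3 := Complex.Gamma_add_nat_div_Gamma_eq (n := m) (α + k + 1) hc
    have e4 : α + ((k + m : ℕ) : ℂ) + 1 = α + k + 1 + m := by push_cast; ring
    rw [e1, e2, ← e3, e4, smul_eq_mul]
    rw [e4] at hGm
    have hk : (k.factorial : ℂ) ≠ 0 := by exact_mod_cast k.factorial_ne_zero
    have hm : (m.factorial : ℂ) ≠ 0 := by exact_mod_cast m.factorial_ne_zero
    field_simp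
  have hex : ∃ g : ℂ → ℂ, IsHypergeometricBranch (k + 1) 1 (α + k + 1) g := ⟨g, hg⟩
  rw [hyp2F1, dif_pos hex]
  have h0 : (0 : ℂ) ∈ cutPlane := by simp [cutPlane]
  refine hex.choose_spec.1.eqOn_of_preconnected_of_eventuallyEq hg.1
    (starZero_cutPlane.isPreconnected h0) h0 ?_ hz
  filter_upwards [Metric.ball_mem_nhds (0 : ℂ) one_pos] with x hx
  rw [hex.choose_spec.2 hx, hg.2 hx]

/-! ### The series representation -/

/-- The derivative of `u ↦ u^k / (ξ - ut)`: the integrand of `hypKernel`, with `z = t / ξ`, divided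
by `ξ`. As a function of `ξ` it is a combination of Cauchy kernels with pole `ut`. -/
noncomputable def poleKernel (k : ℕ) (t ξ : ℂ) (u : ℝ) : ℂ :=
  k * (u : ℂ) ^ (k - 1) * (ξ - u * t)⁻¹ + t * (u : ℂ) ^ k * (ξ - u * t)⁻¹ ^ 2

theorem hypKernel_div_mul_inv (α : ℂ) (k : ℕ) (t : ℂ) {ξ : ℂ} (hξ : ξ ≠ 0) :
    hypKernel α k (t / ξ) * ξ⁻¹ =
      0 ^ k * ξ⁻¹ + ∫ u in (0 : ℝ)..1, ((1 - u : ℝ) : ℂ) ^ α * poleKernel k t ξ u := by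
  rw [hypKernel, add_mul, ← intervalIntegral.integral_mul_const]
  congr 2
  ext u
  have h : (1 - u * (t / ξ))⁻¹ = ξ * (ξ - u * t)⁻¹ := by
    have : 1 - u * (t / ξ) = (ξ - u * t) * ξ⁻¹ := by field_simp
    rw [this, mul_inv, inv_inv, mul_comm]
  rw [poleKernel, h]
  field_simp

theorem norm_poleKernel_le (k : ℕ) {t ξ : ℂ} {u δ : ℝ} (hu : u ∈ Icc (0 : ℝ) 1) (hδ : 0 < δ)
    (h : δ ≤ ‖ξ - u * t‖) : ‖poleKernel k t ξ u‖ ≤ k * δ⁻¹ + ‖t‖ * δ⁻¹ ^ 2 := by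
  have hu1 : ‖(u : ℂ)‖ ≤ 1 := by
    rw [Complex.norm_real, Real.norm_of_nonneg hu.1]; exact hu.2
  have hinv : ‖(ξ - u * t)⁻¹‖ ≤ δ⁻¹ := by rw [norm_inv]; exact inv_anti₀ hδ h
  refine (norm_add_le _ _).trans ?_
  rw [norm_mul, norm_mul, norm_mul, norm_mul, norm_pow, norm_pow, norm_pow, Complex.norm_natCast]
  gcongr
  · exact mul_le_of_le_one_right (Nat.cast_nonneg k) (pow_le_one₀ (norm_nonneg _) hu1)
  · exact mul_le_of_le_one_right (norm_nonneg _) (pow_le_one₀ (norm_nonneg _) hu1)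

theorem div_gammaPath_mem_cutPlane {A : ℝ} (hA : 0 < A) {t : ℂ} (ht : t ∈ regionD A) (s : ℝ) :
    t / gammaPath A s ∈ cutPlane := by
  set ξ := gammaPath A s with hξ
  have hξ0 : ξ ≠ 0 := gammaPath_ne_zero hA s
  change 1 - t / ξ ∈ Complex.slitPlane
  rw [Complex.mem_slitPlane_iff_not_le_zero]
  intro h
  rw [Complex.le_def] at h
  -- otherwise `t = pξ` with a real `p ≥ 1`, so that `ξ = p⁻¹ t` would lie in the region
  set p := (t / ξ).re with hp
  have hp1 : 1 ≤ p := by have := h.1; simp at this; linarith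
  have hpt : t / ξ = p := by
    have := h.2
    simp only [Complex.sub_im, Complex.one_im, Complex.zero_im, zero_sub, neg_eq_zero] at this
    apply Complex.ext
    · simp [hp]
    · simpa using this
  have hp0 : (p : ℂ) ≠ 0 := by exact_mod_cast (by linarith : p ≠ 0)
  have hmem := starZero_regionD A t ht p⁻¹
    ⟨inv_nonneg.2 (by linarith), inv_le_one_of_one_le₀ hp1⟩
  have : ((p⁻¹ : ℝ) : ℂ) * t = ξ := by
    rw [div_eq_iff hξ0] at hpt
    rw [hpt]
    push_cast
    field_simp
  rw [this] at hmem
  exact gammaPath_notMem_regionD hA s hmem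

section Coefficients

variable {a R r A : ℝ} {α : ℂ} {F : ℂ → ℂ} {t : ℂ}

theorem coeffIntegrand_gammaPath (hα : -1 < α.re) (hA : 0 < A) (ht : t ∈ regionD A) (k : ℕ)
    (s : ℝ) : coeffIntegrand F α r t k (gammaPath A s) =
      Complex.Gamma (α + k + 1) / (k.factorial * Complex.Gamma (α + 1)) *
        (0 ^ k * ((gammaPath A s)⁻¹ * (Complex.exp (-r * gammaPath A s) * F (gammaPath A s))) +
          (∫ u in (0 : ℝ)..1, ((1 - u : ℝ) : ℂ) ^ α * poleKernel k t (gammaPath A s) u) *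
            (Complex.exp (-r * gammaPath A s) * F (gammaPath A s))) := by
  have h := hypKernel_div_mul_inv α k t (gammaPath_ne_zero hA s)
  rw [coeffIntegrand, hyp2F1_eq hα k (div_gammaPath_mem_cutPlane hA ht s)]
  linear_combination Complex.Gamma (α + k + 1) / (k.factorial * Complex.Gamma (α + 1)) *
    (Complex.exp (-r * gammaPath A s) * F (gammaPath A s)) * h

/-- Absolute integrability for the interchange of the path integral and the `u`-integral: the
poles `ut`, `0 ≤ u ≤ 1`, stay at a positive distance from the path. -/
theorem integrable_poleKernel (hα : -1 < α.re) (hA : 0 < A) (ht : t ∈ regionD A) (k : ℕ)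
    {f : ℝ → ℂ} (hf : Integrable f) :
    Integrable (fun p : ℝ × ℝ => ((1 - p.1 : ℝ) : ℂ) ^ α * poleKernel k t (gammaPath A p.2) p.1 *
      f p.2) ((volume.restrict (Ioc 0 1)).prod volume) := by
  obtain ⟨δ, hδ, hdist⟩ := exists_forall_le_norm_sub hA ht
  have hw : Integrable (fun u : ℝ => ((1 - u : ℝ) : ℂ) ^ α) (volume.restrict (Ioc 0 1)) :=
    (intervalIntegrable_iff_integrableOn_Ioc_of_le zero_le_one).1
      (intervalIntegrable_one_sub_cpow hα)
  have hprod := hw.mul_prod hf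
  have hmeas : Measurable fun p : ℝ × ℝ => poleKernel k t (gammaPath A p.2) p.1 := by
    have := (continuous_gammaPath hA).measurable
    unfold poleKernel
    fun_prop
  have hbd : ∀ᵐ p ∂((volume.restrict (Ioc (0 : ℝ) 1)).prod (volume : Measure ℝ)),
      ‖poleKernel k t (gammaPath A p.2) p.1‖ ≤ k * δ⁻¹ + ‖t‖ * δ⁻¹ ^ 2 := by
    have hm : (volume.restrict (Ioc (0 : ℝ) 1)).prod (volume : Measure ℝ) =
        (volume.prod volume).restrict (Ioc (0 : ℝ) 1 ×ˢ univ) := by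
      rw [← Measure.prod_restrict, Measure.restrict_univ]
    rw [hm]
    refine (ae_restrict_iff' (measurableSet_Ioc.prod MeasurableSet.univ)).2
      (Eventually.of_forall fun p hp => ?_)
    have hp1 : p.1 ∈ Icc (0 : ℝ) 1 := Ioc_subset_Icc_self hp.1
    exact norm_poleKernel_le k hp1 hδ (hdist _ (gammaPath_notMem_regionD hA p.2) _ hp1)
  refine (hprod.bdd_mul hmeas.aestronglyMeasurable hbd).congr (Eventually.of_forall fun p => ?_)
  ring

/-- Cauchy's formula and its derivative, applied to `poleKernel`. -/
theorem MemH.integral_poleKernel (hF : MemH a R F) (hR : 0 ≤ R) (hr : R < r) (hA : 0 < A)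
    (hAa : A < a) (ht : t ∈ regionD A) (k : ℕ) {u : ℝ} (hu : u ∈ Icc (0 : ℝ) 1) :
    ∫ s : ℝ, poleKernel k t (gammaPath A s) u *
        (Complex.exp (-r * gammaPath A s) * F (gammaPath A s) * deriv (gammaPath A) s) =
      2 * Real.pi * Complex.I * (k * (u : ℂ) ^ (k - 1) * (Complex.exp (-r * (u * t)) * F (u * t)) +
        t * (u : ℂ) ^ k * deriv (fun w => Complex.exp (-r * w) * F w) (u * t)) := by
  have hmem := starZero_regionD A t ht u hu
  have hint := hF.contourIntegrable_exp_mul hR hr hA hAa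
  have hi1 := hint.inv_sub_mul hA hmem
  have hi2 := hi1.inv_sub_mul hA hmem
  have h1 := hF.cauchy hR hr hA hAa hmem
  have h2 := hF.cauchy_deriv hR hr hA hAa hmem
  have e : ∀ s : ℝ, poleKernel k t (gammaPath A s) u *
      (Complex.exp (-r * gammaPath A s) * F (gammaPath A s) * deriv (gammaPath A) s) =
      k * (u : ℂ) ^ (k - 1) * ((gammaPath A s - u * t)⁻¹ *
        (Complex.exp (-r * gammaPath A s) * F (gammaPath A s)) * deriv (gammaPath A) s) +
      t * (u : ℂ) ^ k * ((gammaPath A s - u * t)⁻¹ * ((gammaPath A s - u * t)⁻¹ *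
        (Complex.exp (-r * gammaPath A s) * F (gammaPath A s))) * deriv (gammaPath A) s) := by
    intro s
    rw [poleKernel]
    ring
  simp_rw [e]
  rw [integral_add (Integrable.const_mul hi1 _) (Integrable.const_mul hi2 _), integral_const_mul,
    integral_const_mul]
  rw [contourIntegral] at h1 h2
  rw [h1, h2]
  ring

/-- The path integral of the `k`-th coefficient exists, and the `k`-th term is the fractional
integral, in the variable `u`, of `(rtu)^k / k! · exp (-rtu) F(ut)`. -/
theorem MemH.seriesTerm_eq (hF : MemH a R F) (hR : 0 ≤ R) (hα : -1 < α.re) (hr : R < r)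
    (hA : 0 < A) (hAa : A < a) (ht : t ∈ regionD A) (k : ℕ) :
    ContourIntegrable A (coeffIntegrand F α r t k) ∧
    seriesTerm F A α r t k = (r * t) ^ k / (k.factorial * Complex.Gamma (α + 1)) *
      (0 ^ k * F 0 + ∫ u in (0 : ℝ)..1, ((1 - u : ℝ) : ℂ) ^ α *
        (k * (u : ℂ) ^ (k - 1) * (Complex.exp (-r * (u * t)) * F (u * t)) +
          t * (u : ℂ) ^ k * deriv (fun w => Complex.exp (-r * w) * F w) (u * t))) := by
  set E : ℂ → ℂ := fun ξ => Complex.exp (-r * ξ) * F ξ with hE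
  set K : ℂ := Complex.Gamma (α + k + 1) / (k.factorial * Complex.Gamma (α + 1)) with hK
  have hint : ContourIntegrable A E := hF.contourIntegrable_exp_mul hR hr hA hAa
  have h0mem : (0 : ℂ) ∈ regionD A := by simpa using ofReal_mem_regionD hA le_rfl
  have hi0 : Integrable fun s : ℝ =>
      (gammaPath A s)⁻¹ * E (gammaPath A s) * deriv (gammaPath A) s := by
    have := hint.inv_sub_mul hA h0mem
    unfold ContourIntegrable at this
    simpa only [sub_zero] using this
  have hprod := integrable_poleKernel hα hA ht k hint
  have hi1 := hprod.integral_prod_right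
  have hpt : ∀ s : ℝ, coeffIntegrand F α r t k (gammaPath A s) * deriv (gammaPath A) s =
      K * (0 ^ k * ((gammaPath A s)⁻¹ * E (gammaPath A s) * deriv (gammaPath A) s) +
        ∫ u in Ioc (0 : ℝ) 1, ((1 - u : ℝ) : ℂ) ^ α * poleKernel k t (gammaPath A s) u *
          (E (gammaPath A s) * deriv (gammaPath A) s)) := by
    intro s
    rw [coeffIntegrand_gammaPath hα hA ht k s, integral_mul_const,
      intervalIntegral.integral_of_le zero_le_one]
    ring
  have hfull := ((hi0.const_mul (0 ^ k)).add hi1).const_mul K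
  refine ⟨hfull.congr (Eventually.of_forall fun s => (hpt s).symm), ?_⟩
  have hswap := integral_integral_swap (f := fun u s : ℝ => ((1 - u : ℝ) : ℂ) ^ α *
    poleKernel k t (gammaPath A s) u * (E (gammaPath A s) * deriv (gammaPath A) s)) hprod
  have hinner : ∀ u ∈ Ioc (0 : ℝ) 1, ∫ s : ℝ, ((1 - u : ℝ) : ℂ) ^ α *
      poleKernel k t (gammaPath A s) u * (E (gammaPath A s) * deriv (gammaPath A) s) =
      2 * Real.pi * Complex.I * (((1 - u : ℝ) : ℂ) ^ α * (k * (u : ℂ) ^ (k - 1) * E (u * t) +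
        t * (u : ℂ) ^ k * deriv E (u * t))) := by
    intro u hu
    simp_rw [mul_assoc (((1 - u : ℝ) : ℂ) ^ α)]
    rw [integral_const_mul, hF.integral_poleKernel hR hr hA hAa ht k (Ioc_subset_Icc_self hu)]
    ring
  rw [setIntegral_congr_fun measurableSet_Ioc hinner, integral_const_mul] at hswap
  have hC0 : ∫ s : ℝ, (gammaPath A s)⁻¹ * E (gammaPath A s) * deriv (gammaPath A) s =
      2 * Real.pi * Complex.I * F 0 := by
    have h := hF.cauchy hR hr hA hAa h0mem
    rw [contourIntegral] at h
    simpa [hE] using h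
  have hcoeff : contourIntegral A (coeffIntegrand F α r t k) = 2 * Real.pi * Complex.I *
      (K * (0 ^ k * F 0 + ∫ u in Ioc (0 : ℝ) 1, ((1 - u : ℝ) : ℂ) ^ α *
        (k * (u : ℂ) ^ (k - 1) * E (u * t) + t * (u : ℂ) ^ k * deriv E (u * t)))) := by
    rw [contourIntegral]
    simp_rw [hpt]
    rw [integral_const_mul, integral_add (hi0.const_mul _) hi1, integral_const_mul, hC0, ← hswap]
    ring
  have hG1 := Gamma_add_one_ne_zero hα
  have hGk := Gamma_add_ne_zero hα k
  have hk : (k.factorial : ℂ) ≠ 0 := by exact_mod_cast k.factorial_ne_zero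
  have hpi : (2 * Real.pi * Complex.I : ℂ) ≠ 0 := Complex.two_pi_I_ne_zero
  have key : ∀ Z : ℂ, 1 / Complex.Gamma (α + k + 1) * (r * t) ^ k * (K * Z) =
      (r * t) ^ k / (k.factorial * Complex.Gamma (α + 1)) * Z := by
    intro Z
    rw [hK]
    field_simp
  rw [seriesTerm, coeff, hcoeff, intervalIntegral.integral_of_le zero_le_one,
    one_div (2 * Real.pi * Complex.I : ℂ), inv_mul_cancel_left₀ hpi]
  exact key _

end Coefficients

theorem summable_mul_pow_div_factorial (x p q : ℝ) :
    Summable fun k : ℕ => |x| ^ k / k.factorial * (k * p + q) := by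
  have h1 : Summable fun k : ℕ => |x| ^ k / k.factorial * (k : ℝ) := by
    rw [← summable_nat_add_iff 1]
    refine ((Real.summable_pow_div_factorial |x|).mul_left |x|).congr fun k => ?_
    have : ((k : ℝ) + 1) ≠ 0 := by positivity
    rw [Nat.factorial_succ]
    push_cast
    field_simp
    ring
  refine ((h1.mul_right p).add ((Real.summable_pow_div_factorial |x|).mul_right q)).congr
    fun k => ?_
  ring

/-- The exponential series and its derivative. -/
theorem hasSum_exp_mul_add (x u p q : ℂ) :
    HasSum (fun k : ℕ => x ^ k / k.factorial * (k * u ^ (k - 1) * p + q * u ^ k))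
      (Complex.exp (x * u) * (x * p + q)) := by
  have he : HasSum (fun k : ℕ => (x * u) ^ k / (k.factorial : ℂ)) (Complex.exp (x * u)) := by
    rw [Complex.exp_eq_exp_ℂ]
    exact NormedSpace.expSeries_div_hasSum_exp (x * u)
  have h1 : HasSum (fun k : ℕ => x ^ k / k.factorial * (k * u ^ (k - 1)))
      (x * Complex.exp (x * u)) := by
    have h := he.mul_left x
    rw [← hasSum_nat_add_iff' 1]
    simp only [Finset.range_one, Finset.sum_singleton, Nat.cast_zero, zero_mul, mul_zero, sub_zero]
    refine h.congr_fun fun k => ?_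
    have : ((k : ℂ) + 1) ≠ 0 := by exact_mod_cast k.succ_ne_zero
    rw [Nat.factorial_succ, Nat.add_sub_cancel, mul_pow]
    push_cast
    field_simp
    ring
  have hv : Complex.exp (x * u) * (x * p + q) =
      x * Complex.exp (x * u) * p + Complex.exp (x * u) * q := by ring
  rw [hv]
  refine ((h1.mul_right p).add (he.mul_right q)).congr_fun fun k => ?_
  rw [mul_pow]
  ring

section Representation

variable {a R r A : ℝ} {α : ℂ} {F : ℂ → ℂ} {t : ℂ}

/-- The series converges to the fractional integral: summing `(rtu)^k / k! · exp (-rtu) F(ut)`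
over `k` gives `F(ut)`, and the derivatives in `u` converge uniformly on `[0, 1]`. -/
theorem MemH.hasSum_seriesTerm (hF : MemH a R F) (hR : 0 ≤ R) (hα : -1 < α.re) (hr : R < r)
    (hA : 0 < A) (hAa : A < a) (ht : t ∈ regionD A) :
    Summable (fun k : ℕ => ‖seriesTerm F A α r t k‖) ∧
      HasSum (fun k : ℕ => seriesTerm F A α r t k) (fracInt α F t) := by
  set E : ℂ → ℂ := fun ξ => Complex.exp (-r * ξ) * F ξ with hE
  have hta : t ∈ regionD a := regionD_mono hAa.le ht
  have hEd : DifferentiableOn ℂ E (regionD a) :=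
    DifferentiableOn.mul (by fun_prop) hF.differentiableOn
  have hEc := (starZero_regionD a).continuousOn_comp_mul hEd.continuousOn hta
  have hEc' := (starZero_regionD a).continuousOn_comp_mul
    (hEd.deriv (isOpen_regionD a)).continuousOn hta
  obtain ⟨M, hM⟩ := isCompact_Icc.exists_bound_of_continuousOn hEc
  obtain ⟨M', hM'⟩ := isCompact_Icc.exists_bound_of_continuousOn hEc'
  have hM0 : 0 ≤ M := (norm_nonneg _).trans (hM 0 (by simp))
  have hM0' : 0 ≤ M' := (norm_nonneg _).trans (hM' 0 (by simp))
  have hw := intervalIntegrable_one_sub_cpow hα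
  set w : ℝ → ℂ := fun u => ((1 - u : ℝ) : ℂ) ^ α with hwdef
  set φ : ℕ → ℝ → ℂ := fun k u =>
    k * (u : ℂ) ^ (k - 1) * E (u * t) + t * (u : ℂ) ^ k * deriv E (u * t) with hφ
  have hφc : ∀ k, ContinuousOn (φ k) (uIcc 0 1) := by
    intro k
    rw [uIcc_of_le zero_le_one]
    exact (ContinuousOn.mul (by fun_prop) hEc).add (ContinuousOn.mul (by fun_prop) hEc')
  have hφb : ∀ k, ∀ u ∈ Icc (0 : ℝ) 1, ‖φ k u‖ ≤ k * M + ‖t‖ * M' := by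
    intro k u hu
    have hu1 : ‖(u : ℂ)‖ ≤ 1 := by
      rw [Complex.norm_real, Real.norm_of_nonneg hu.1]; exact hu.2
    refine (norm_add_le _ _).trans ?_
    rw [norm_mul _ (E _), norm_mul (k : ℂ), norm_mul _ (deriv E _), norm_mul t, norm_pow, norm_pow,
      Complex.norm_natCast]
    have h1 := hM u hu
    have h2 := hM' u hu
    gcongr
    · exact mul_le_of_le_one_right (Nat.cast_nonneg k) (pow_le_one₀ (norm_nonneg _) hu1)
    · exact mul_le_of_le_one_right (norm_nonneg _) (pow_le_one₀ (norm_nonneg _) hu1)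
  have hterm : ∀ k : ℕ, seriesTerm F A α r t k = ((r * t) ^ k / k.factorial *
      (0 ^ k * F 0 + ∫ u in (0 : ℝ)..1, w u * φ k u)) / Complex.Gamma (α + 1) := by
    intro k
    rw [(hF.seriesTerm_eq hR hα hr hA hAa ht k).2]
    simp only [hwdef, hφ, hE]
    rw [← div_div, mul_div_right_comm, div_mul_eq_mul_div, mul_div_right_comm]
  have hnormrt : ∀ k : ℕ, ‖(r * t : ℂ) ^ k / k.factorial‖ = |‖(r * t : ℂ)‖| ^ k / k.factorial := by
    intro k
    rw [norm_div, norm_pow, Complex.norm_natCast, abs_norm]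
  constructor
  · set W : ℝ := ∫ u in (0 : ℝ)..1, ‖w u‖ with hW
    refine Summable.of_nonneg_of_le (fun _ => norm_nonneg _) (fun k => ?_)
      ((summable_mul_pow_div_factorial ‖(r * t : ℂ)‖ (W * M) (‖F 0‖ + W * (‖t‖ * M'))).div_const
        ‖Complex.Gamma (α + 1)‖)
    rw [hterm, norm_div, norm_mul, hnormrt]
    gcongr
    have h1 : ‖∫ u in (0 : ℝ)..1, w u * φ k u‖ ≤ W * (k * M + ‖t‖ * M') := by
      rw [hW, ← intervalIntegral.integral_mul_const]
      refine intervalIntegral.norm_integral_le_of_norm_le zero_le_one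
        (Eventually.of_forall fun u hu => ?_) (hw.norm.mul_const _)
      rw [norm_mul]
      exact mul_le_mul_of_nonneg_left (hφb k u (Ioc_subset_Icc_self hu)) (norm_nonneg _)
    have h2 : ‖(0 : ℂ) ^ k * F 0‖ ≤ ‖F 0‖ := by
      rw [norm_mul, norm_pow, norm_zero]
      exact mul_le_of_le_one_left (norm_nonneg _) (pow_le_one₀ le_rfl zero_le_one)
    refine (norm_add_le _ _).trans ((add_le_add h2 h1).trans_eq ?_)
    ring
  · have hI : HasSum (fun k : ℕ => ∫ u in (0 : ℝ)..1, w u * ((r * t) ^ k / k.factorial * φ k u))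
        (∫ u in (0 : ℝ)..1, w u * (t * deriv F (u * t))) := by
      have hsb := summable_mul_pow_div_factorial ‖(r * t : ℂ)‖ M (‖t‖ * M')
      refine intervalIntegral.hasSum_integral_of_dominated_convergence
        (fun k u => ‖w u‖ * (|‖(r * t : ℂ)‖| ^ k / k.factorial * (k * M + ‖t‖ * M'))) ?_ ?_ ?_ ?_ ?_
      · intro k
        exact (hw.mul_continuousOn (continuousOn_const.mul (hφc k))).def'.aestronglyMeasurable
      · refine fun k => Eventually.of_forall fun u hu => ?_
        rw [uIoc_of_le zero_le_one] at hu
        rw [norm_mul, norm_mul, hnormrt]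
        have := hφb k u (Ioc_subset_Icc_self hu)
        gcongr
      · exact Eventually.of_forall fun u _ => hsb.mul_left _
      · simp_rw [tsum_mul_left]
        exact hw.norm.mul_const _
      · refine Eventually.of_forall fun u hu => ?_
        rw [uIoc_of_le zero_le_one] at hu
        have hmem := starZero_regionD a t hta u (Ioc_subset_Icc_self hu)
        have hFd : HasDerivAt F (deriv F (u * t)) ((u : ℂ) * t) :=
          (hF.differentiableOn.differentiableAt ((isOpen_regionD a).mem_nhds hmem)).hasDerivAt
        have hEderiv : deriv E (u * t) =
            Complex.exp (-r * (u * t)) * (deriv F (u * t) - r * F (u * t)) := by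
          have h := ((hasDerivAt_id ((u : ℂ) * t)).const_mul (-r : ℂ)).cexp.mul hFd
          have h' : HasDerivAt E _ ((u : ℂ) * t) := h
          rw [h'.deriv]
          simp only [id]
          ring
        have hs := (hasSum_exp_mul_add (r * t) u (E (u * t)) (t * deriv E (u * t))).mul_left (w u)
        have hval : w u * (t * deriv F (u * t)) = w u * (Complex.exp (r * t * u) *
            (r * t * E (u * t) + t * deriv E (u * t))) := by
          have hexp : Complex.exp (r * t * u) * Complex.exp (-r * (u * t)) = 1 := by
            rw [← Complex.exp_add, ← Complex.exp_zero]; congr 1; ring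
          rw [hEderiv]
          simp only [hE]
          linear_combination (-(w u * t * deriv F (u * t))) * hexp
        rw [hval]
        refine hs.congr_fun fun k => ?_
        simp only [hφ]
        ring
    have h0 : HasSum (fun k : ℕ => (r * t : ℂ) ^ k / k.factorial * (0 ^ k * F 0)) (F 0) := by
      have := hasSum_single (f := fun k : ℕ => (r * t : ℂ) ^ k / k.factorial * (0 ^ k * F 0)) 0
        (fun k hk => by simp [hk])
      simpa using this
    have hfrac : fracInt α F t = (F 0 + ∫ u in (0 : ℝ)..1, w u * (t * deriv F (u * t))) /
        Complex.Gamma (α + 1) := by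
      rw [fracInt, ← intervalIntegral.integral_const_mul]
      congr 3
      ext u
      ring
    rw [hfrac]
    refine ((h0.add hI).div_const _).congr_fun fun k => ?_
    rw [hterm, mul_add, ← intervalIntegral.integral_const_mul]
    congr 3
    ext u
    ring

end Representation

end FracCalc

theorem theorem7 (a R : ℝ) (ha : 0 < a) (hR : 0 ≤ R) (α : ℂ) (hα : -1 < α.re)
    (F : ℂ → ℂ) (hF : FracCalc.MemH a R F) :
    ∃ Fs : ℂ → ℂ,
      -- `Fs = 𝓘_α F`, and `Fs` is in `H(a, R)`
      FracCalc.IsFracIntegral R α F Fs ∧ FracCalc.MemH a R Fs ∧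
      -- the function `𝓘_α F` is uniquely determined within the union of all spaces `H(a', R')`
      (∀ (a' R' : ℝ) (G : ℂ → ℂ), 0 < a' → 0 ≤ R' → FracCalc.MemH a' R' G →
        FracCalc.IsFracIntegral R' α F G →
        Set.EqOn G Fs (FracCalc.regionD (min a a'))) ∧
      -- the integral representation
      ∀ r A : ℝ, R < r → 0 < A → A < a → ∀ t ∈ FracCalc.regionD A,
        (∀ k : ℕ, FracCalc.ContourIntegrable A (FracCalc.coeffIntegrand F α r t k)) ∧
        Summable (fun k : ℕ => ‖FracCalc.seriesTerm F A α r t k‖) ∧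
        HasSum (fun k : ℕ => FracCalc.seriesTerm F A α r t k) (Fs t) := by
  have hI := FracCalc.isFracIntegral_fracInt ha hR hα hF
  have hH := FracCalc.memH_fracInt hR hα hF
  exact ⟨FracCalc.fracInt α F, hI, hH,
    fun a' R' G ha' _ hG hGI => (hI.eqOn ha ha' hR hGI hH hG).symm,
    fun r A hr hA hAa t ht =>
      ⟨fun k => (hF.seriesTerm_eq hR hα hr hA hAa ht k).1,
        hF.hasSum_seriesTerm hR hα hr hA hAa ht⟩⟩
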